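/- Let $A_0$ be a Noetherian integral domain, $d$ an even positive integer, $r_0,\dots,r_d\in A_0$, and $a\ge 0$ an integer. For $n\ge 0$ let $M_n$ be the $n\times n$ Toeplitz matrix whose $(i,j)$ entry is $r_{d/2+i-j}$ if $0\le d/2+i-j\le d$, and $0$ otherwise (so $r_{d/2}$ is on the main diagonal, $r_0$ on the outermost nonzero superdiagonal, $r_d$ on the outermost nonzero subdiagonal, and $\det M_0=1$). For an element $f$ of $A_0$ let $\operatorname{Min}(f)$ be the set of minimal primes of the ideal $fA_0$. Let $\mathbb S\subseteq\mathbb N$ be a subset such that $$\bigcup_{n\in\mathbb S,\ n\ge a+d/2}\operatorname{Min}\big(\det M_{n-a-d/2}\big)$$ is an infinite set. Let $u,v,x,y$ be variables over $A_0$ and put $$A=A_0[x,y]/(xy)^a\big(r_0x^d+r_1x^{d-1}y+\dots+r_dy^d\big),$$ $$R=A_0[u,v,x,y]/\big(r_0(ux)^d+r_1(ux)^{d-1}(vy)+\dots+r_d(vy)^d\big).$$ (1) The set $\bigcup_{n\in\mathbb S}\operatorname{Ass}_A A/(x^n,y^n)$ is infinite. (2) If $r_0$ and $r_d$ are nonzero,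 then the local cohomology module $H^2_{(x,y)}(R)$ has infinitely many associated primes. (3) Suppose that either $A_0$ is local with maximal ideal $\mathfrak m$, or $A_0$ is $\mathbb N$-graded with homogeneous maximal ideal $\mathfrak m$ (a homogeneous maximal ideal that contains every proper homogeneous ideal of $A_0$) and $\det M_n$ is a homogeneous element of $A_0$ for all $n\ge 0$. Then $\mathfrak M_A=(\mathfrak m+(x,y))A$ is a maximal ideal of $A$, and $\bigcup_{n\in\mathbb S}\operatorname{Ass} A_{\mathfrak M_A}/(x^n,y^n)$ is infinite. If moreover $r_0$ and $r_d$ are nonzero, then $\mathfrak M_R=(\mathfrak m+(u,v,x,y))R$ is a maximal ideal of $R$, and $H^2_{(x,y)}(R_{\mathfrak M_R})$ has infinitely many associated primes. -/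

import Mathlib

/-- The `n`-th multidiagonal matrix with respect to `r₀, …, r_d` (`d` even): the `n × n` matrix
with `r_{d/2}` on the main diagonal, `r_{d/2-1}, …, r₀` on the successive superdiagonals,
`r_{d/2+1}, …, r_d` on the successive subdiagonals, and zeros elsewhere.  Its `(i, j)` entry is
`r_{d/2 + i - j}` if `0 ≤ d/2 + i - j ≤ d`, and `0` otherwise. -/
def multidiagonal {A₀ : Type*} [CommRing A₀] {d : ℕ} (r : Fin (d + 1) → A₀) (n : ℕ) :
    Matrix (Fin n) (Fin n) A₀ :=
  Matrix.of fun i j =>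
    if h : (j : ℕ) ≤ d / 2 + i ∧ d / 2 + i - j < d + 1 then r ⟨d / 2 + i - j, h.2⟩ else 0

/-- For `x, y` in a commutative ring `B`, the union over `n ∈ S` of the sets `Ass B/(xⁿ, yⁿ)`. -/
def assPowers {B : Type*} [CommRing B] (S : Set ℕ) (x y : B) : Set (Ideal B) :=
  ⋃ n ∈ S, associatedPrimes B (B ⧸ Ideal.span {x ^ n, y ^ n})

universe u

/-- The set of associated primes of the local cohomology module `H²_{(x, y)}(B)`. -/
noncomputable def assLocalCohomologyTwo {B : Type u} [CommRing B] (x y : B) : Set (Ideal B) :=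
  associatedPrimes B ((localCohomology (Ideal.span {x, y}) 2).obj (ModuleCat.of B B))

/-- `m` is the homogeneous maximal ideal of the `ℕ`-graded ring `A₀`: it is a homogeneous maximal
ideal, and it contains every proper homogeneous ideal.  (If the degree zero component is a field,
`m` is the ideal generated by the elements of positive degree.) -/
structure IsHomogeneousMaximalIdeal {A₀ : Type*} [CommRing A₀] (𝒜 : ℕ → AddSubgroup A₀)
    [GradedRing 𝒜] (m : Ideal A₀) : Prop where
  isHomogeneous : m.IsHomogeneous 𝒜
  isMaximal : m.IsMaximal
  le_of_isHomogeneous : ∀ I : Ideal A₀, I.IsHomogeneous 𝒜 → I ≠ ⊤ → I ≤ m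

section Hypersurfaces

variable {A₀ : Type u} [CommRing A₀] {d : ℕ}

/-- The binary form `r₀ s^d + r₁ s^{d-1} t + ⋯ + r_d t^d` evaluated at elements `s, t` of an
`A₀`-algebra. -/
def binaryForm {B : Type*} [CommRing B] [Algebra A₀ B] (r : Fin (d + 1) → A₀) (s t : B) : B :=
  ∑ i : Fin (d + 1), algebraMap A₀ B (r i) * s ^ (d - (i : ℕ)) * t ^ (i : ℕ)

/-- `A = A₀[x, y] / ((xy)^a (r₀ x^d + r₁ x^{d-1} y + ⋯ + r_d y^d))`. -/
abbrev HypersurfaceA (r : Fin (d + 1) → A₀) (a : ℕ) : Type u :=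
  MvPolynomial (Fin 2) A₀ ⧸
    Ideal.span {((MvPolynomial.X 0 * MvPolynomial.X 1) ^ a *
      binaryForm r (MvPolynomial.X 0) (MvPolynomial.X 1) : MvPolynomial (Fin 2) A₀)}

/-- The images of the variables `x, y` (numbered `0, 1`) in `A`. -/
noncomputable def HypersurfaceA.var (r : Fin (d + 1) → A₀) (a : ℕ) (k : Fin 2) :
    HypersurfaceA r a :=
  Ideal.Quotient.mk _ (MvPolynomial.X k)

/-- The ideal `(m + (x, y))A`. -/
noncomputable def HypersurfaceA.maxIdeal (r : Fin (d + 1) → A₀) (a : ℕ) (m : Ideal A₀) :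
    Ideal (HypersurfaceA r a) :=
  m.map (algebraMap A₀ (HypersurfaceA r a)) ⊔ Ideal.span {var r a 0, var r a 1}

/-- `R = A₀[u, v, x, y] / (r₀ (ux)^d + r₁ (ux)^{d-1} (vy) + ⋯ + r_d (vy)^d)`, with the variables
`u, v, x, y` numbered `0, 1, 2, 3`. -/
abbrev HypersurfaceR (r : Fin (d + 1) → A₀) : Type u :=
  MvPolynomial (Fin 4) A₀ ⧸
    Ideal.span {(binaryForm r (MvPolynomial.X 0 * MvPolynomial.X 2)
      (MvPolynomial.X 1 * MvPolynomial.X 3) : MvPolynomial (Fin 4) A₀)}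

/-- The images of the variables `u, v, x, y` (numbered `0, 1, 2, 3`) in `R`. -/
noncomputable def HypersurfaceR.var (r : Fin (d + 1) → A₀) (k : Fin 4) : HypersurfaceR r :=
  Ideal.Quotient.mk _ (MvPolynomial.X k)

/-- The ideal `(m + (u, v, x, y))R`. -/
noncomputable def HypersurfaceR.maxIdeal (r : Fin (d + 1) → A₀) (m : Ideal A₀) :
    Ideal (HypersurfaceR r) :=
  m.map (algebraMap A₀ (HypersurfaceR r)) ⊔ Ideal.span {var r 0, var r 1, var r 2, var r 3}

end Hypersurfaces

/-! Let F be the form (xy)^a (r₀x^d + ⋯ + r_d y^d) and n = N + a + d/2. In degree N + 2a + d − 1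
exactly N monomials lie outside (xⁿ, yⁿ), and in degree N − 1 there are N monomials in all; between
these bases, multiplication by F is the Toeplitz matrix M_N. So this graded piece of A₀[x, y]/(xⁿ,
yⁿ, F) is coker M_N. The annihilator of coker M_N has the same radical as (det M_N), so every
minimal prime P of det M_N is the annihilator of an element of the cokernel
(`exists_vector_of_mem_minimalPrimes_det`, `exists_annihilator_truncIdeal`). Multiplying by powers
of x and y and by scalars outside P yields w with annihilator P + (x, y) (`exists_annihilator_eq`).
A prime of A₀ that annihilates an element of a module over a Noetherian A₀-algebra is contracted
from an associated prime (`exists_mem_associatedPrimes_comap_eq`), so infinitely many P force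
infinitely many associated primes.

For R, the class of w(ux, vy)/(xy)ⁿ in H² takes the place of w. A scalar c kills it only if c w(ux,
vy)(xy)^k lies in (x^(n+k), y^(n+k)) modulo the equation, for some k. The map `extract`, which keeps
the monomials u^p v^q x^(p+k) y^(q+k), brings this membership back to A₀[x, y] with a = 0. Local
cohomology is the colimit of Ext²(B/I^t, B), I = (x, y), and the class is built by comparing
projective resolutions with Koszul complexes (`exists_ext_two_class`).

Localizing does no harm: g acts on w through its constant term, and elements outside the maximal
ideal have constant term outside m, hence outside P. In the graded case P ≤ m because minimal primes
of a homogeneous ideal are homogeneous. -/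

section

open CategoryTheory Limits Opposite

/-! ### Maps out of second homology in an abelian category. -/

section HomologyDesc

variable {V : Type*} [Category V] [Abelian V] {K K' : ChainComplex V ℕ} {W W' : V}

/-- The map out of `H₂(K)` induced by a map on `2`-chains that vanishes on boundaries. -/
noncomputable def homologyDescTwo (ψ : K.X 2 ⟶ W) (h : K.d 3 2 ≫ ψ = 0) : K.homology 2 ⟶ W :=
  K.homologyι 2 ≫ K.descOpcycles ψ 3 (by simp) h

lemma homologyDescTwo_d_comp (χ : K.X 1 ⟶ W) (h : K.d 3 2 ≫ K.d 2 1 ≫ χ = 0) :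
    homologyDescTwo (K.d 2 1 ≫ χ) h = 0 := by
  have h2 : K.descOpcycles (K.d 2 1 ≫ χ) 3 (by simp) h = K.fromOpcycles 2 1 ≫ χ := by
    simp [← cancel_epi (K.pOpcycles 2)]
  rw [homologyDescTwo, h2, HomologicalComplex.homologyι_comp_fromOpcycles_assoc, zero_comp]

/-- `H₂` is the kernel of the map from opcycles to `K.X 1`, so a map on opcycles that vanishes on
`H₂` extends along that map when the target is injective. The target used below is `op B`, injective
because `B` is projective. -/
lemma exists_of_homologyDescTwo_eq_zero [Injective W] {ψ : K.X 2 ⟶ W} {h : K.d 3 2 ≫ ψ = 0}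
    (h0 : homologyDescTwo ψ h = 0) : ∃ χ : K.X 1 ⟶ W, K.d 2 1 ≫ χ = ψ := by
  have hex : (ShortComplex.mk _ _ (K.homologyι_comp_fromOpcycles 2 1)).Exact :=
    ShortComplex.exact_of_f_is_kernel _ (K.homologyIsKernel 2 1 (by simp))
  refine ⟨hex.descToInjective _ h0, ?_⟩
  have := hex.comp_descToInjective _ h0
  dsimp only at this
  rw [← HomologicalComplex.p_fromOpcycles, Category.assoc, this,
    HomologicalComplex.p_descOpcycles]

lemma homologyMap_comp_homologyDescTwo (f : K' ⟶ K) {ψ : K.X 2 ⟶ W} (h : K.d 3 2 ≫ ψ = 0)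
    {ψ' : K'.X 2 ⟶ W} (h' : K'.d 3 2 ≫ ψ' = 0) (hψ : f.f 2 ≫ ψ = ψ') :
    HomologicalComplex.homologyMap f 2 ≫ homologyDescTwo ψ h = homologyDescTwo ψ' h' := by
  subst hψ
  rw [homologyDescTwo, homologyDescTwo, HomologicalComplex.homologyι_naturality_assoc]
  congr 1
  simp

lemma homologyDescTwo_comp {ψ : K.X 2 ⟶ W} (h : K.d 3 2 ≫ ψ = 0) (g : W ⟶ W')
    {ψ' : K.X 2 ⟶ W'} (h' : K.d 3 2 ≫ ψ' = 0) (hψ : ψ ≫ g = ψ') :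
    homologyDescTwo ψ h ≫ g = homologyDescTwo ψ' h' := by
  subst hψ
  rw [homologyDescTwo, homologyDescTwo, Category.assoc]
  congr 1
  simp [← cancel_epi (K.pOpcycles 2)]

end HomologyDesc

/-! ### Ext² by cocycles of a projective resolution, computed in the opposite category. -/

section ExtTwo

variable {B : Type u} [CommRing B] {X X' Y : ModuleCat.{u} B}

/-- The contravariant functor `Hom(-, Y)`, seen as a covariant functor to the opposite category. -/
noncomputable abbrev homInto (Y : ModuleCat.{u} B) : ModuleCat.{u} B ⥤ (ModuleCat.{u} B)ᵒᵖ :=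
  ((linearYoneda B (ModuleCat.{u} B)).obj Y).rightOp

/-- The complex `Hom(P, Y)`, seen in the opposite category. -/
noncomputable def homComplex (P : ProjectiveResolution X) (Y : ModuleCat.{u} B) :
    ChainComplex (ModuleCat.{u} B)ᵒᵖ ℕ :=
  ((homInto Y).mapHomologicalComplex _).obj P.complex

/-- A chain map between projective resolutions induces a map on `Hom(-, Y)`. -/
noncomputable def homComplexMap {P : ProjectiveResolution X} {P' : ProjectiveResolution X'}
    (g : P'.complex ⟶ P.complex) (Y : ModuleCat.{u} B) : homComplex P' Y ⟶ homComplex P Y :=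
  ((homInto Y).mapHomologicalComplex _).map g

/-- `Ext²(X, Y)` is the second homology of `Hom(P, Y)`. -/
noncomputable def extTwoIso (P : ProjectiveResolution X) (Y : ModuleCat.{u} B) :
    op (((Ext B (ModuleCat.{u} B) 2).obj (op X)).obj Y) ≅ (homComplex P Y).homology 2 :=
  P.isoLeftDerivedObj (homInto Y) 2

lemma extTwoIso_hom_naturality (P : ProjectiveResolution X) (P' : ProjectiveResolution X')
    (f : X' ⟶ X) (g : P'.complex ⟶ P.complex) (hg : g.f 0 ≫ P.π.f 0 = P'.π.f 0 ≫ f) :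
    (((Ext B (ModuleCat.{u} B) 2).map f.op).app Y).op ≫ (extTwoIso P Y).hom =
      (extTwoIso P' Y).hom ≫ HomologicalComplex.homologyMap (homComplexMap g Y) 2 :=
  P'.isoLeftDerivedObj_hom_naturality f P g hg (homInto Y) 2

/-- An element of `Hom(Pᵢ, Y)`, seen as a morphism in the opposite category. -/
noncomputable def cochainOp (P : ProjectiveResolution X) {i : ℕ} (φ : P.complex.X i ⟶ Y) :
    (homComplex P Y).X i ⟶ op (ModuleCat.of B B) :=
  Quiver.Hom.op (ModuleCat.ofHom (LinearMap.toSpanSingleton B (P.complex.X i ⟶ Y) φ))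

lemma hom_ext_op_self {Z : (ModuleCat.{u} B)ᵒᵖ} {f g : Z ⟶ op (ModuleCat.of B B)}
    (h : f.unop.hom (1 : B) = g.unop.hom (1 : B)) : f = g := by
  apply Quiver.Hom.unop_inj
  ext
  exact h

lemma cochainOp_one (P : ProjectiveResolution X) {i : ℕ} (φ : P.complex.X i ⟶ Y) :
    (cochainOp P φ).unop.hom (1 : B) = φ :=
  one_smul B φ

lemma cochainOp_injective (P : ProjectiveResolution X) {i : ℕ} : Function.Injective
    (cochainOp P : (P.complex.X i ⟶ Y) → _) := by
  intro φ ψ h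
  rw [← cochainOp_one P φ, h, cochainOp_one]

/-- A linear map out of `B` is determined by its value at `1`, so nothing is lost by encoding
cochains as morphisms. -/
lemma exists_cochainOp_eq (P : ProjectiveResolution X) {i : ℕ}
    (χ : (homComplex P Y).X i ⟶ op (ModuleCat.of B B)) :
    ∃ φ : P.complex.X i ⟶ Y, cochainOp P φ = χ :=
  ⟨χ.unop.hom (1 : B), hom_ext_op_self (cochainOp_one P _)⟩

lemma cochainOp_zero (P : ProjectiveResolution X) {i : ℕ} :
    cochainOp P (0 : P.complex.X i ⟶ Y) = 0 :=
  hom_ext_op_self (cochainOp_one P _)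

lemma homComplexMap_comp_cochainOp {P : ProjectiveResolution X} {P' : ProjectiveResolution X'}
    (g : P'.complex ⟶ P.complex) {i : ℕ} (φ : P.complex.X i ⟶ Y) :
    (homComplexMap g Y).f i ≫ cochainOp P φ = cochainOp P' (g.f i ≫ φ) :=
  hom_ext_op_self ((congr_arg (fun ψ => g.f i ≫ ψ) (cochainOp_one P φ)).trans
    (cochainOp_one P' _).symm)

lemma homComplex_d_comp (P : ProjectiveResolution X) {i j : ℕ} (φ : P.complex.X j ⟶ Y) :
    (homComplex P Y).d i j ≫ cochainOp P φ = cochainOp P (P.complex.d i j ≫ φ) :=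
  hom_ext_op_self ((congr_arg (fun ψ => P.complex.d i j ≫ ψ) (cochainOp_one P φ)).trans
    (cochainOp_one P _).symm)

lemma cochainOp_smul (P : ProjectiveResolution X) {i : ℕ} (φ : P.complex.X i ⟶ Y) (c : B) :
    cochainOp P φ ≫ Quiver.Hom.op (ModuleCat.ofHom (LinearMap.lsmul B B c)) =
      cochainOp P (c • φ) := by
  refine hom_ext_op_self (Eq.trans ?_ (cochainOp_one P _).symm)
  change (c • (1 : B)) • φ = c • φ
  simp

lemma homComplex_d_comp_eq_zero (P : ProjectiveResolution X) {φ : P.complex.X 2 ⟶ Y}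
    (h : P.complex.d 3 2 ≫ φ = 0) : (homComplex P Y).d 3 2 ≫ cochainOp P φ = 0 := by
  rw [homComplex_d_comp, h, cochainOp_zero]

/-- The class in `Ext²(X, Y)` of a `2`-cocycle `φ` of a projective resolution of `X`, as a morphism
from the free module of rank one. -/
noncomputable def extClass (P : ProjectiveResolution X) (φ : P.complex.X 2 ⟶ Y)
    (h : P.complex.d 3 2 ≫ φ = 0) :
    ModuleCat.of B B ⟶ ((Ext B (ModuleCat.{u} B) 2).obj (op X)).obj Y :=
  ((extTwoIso P Y).hom ≫
    homologyDescTwo (cochainOp P φ) (homComplex_d_comp_eq_zero P h)).unop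

lemma extClass_d_comp (P : ProjectiveResolution X) (χ : P.complex.X 1 ⟶ Y)
    {φ : P.complex.X 2 ⟶ Y} (h : P.complex.d 3 2 ≫ φ = 0) (hφ : φ = P.complex.d 2 1 ≫ χ) :
    extClass P φ h = 0 := by
  have hψ : cochainOp P φ = (homComplex P Y).d 2 1 ≫ cochainOp P χ := by
    rw [homComplex_d_comp, hφ]
  unfold extClass
  simp only [hψ]
  rw [homologyDescTwo_d_comp, comp_zero, unop_zero]

lemma exists_of_extClass_eq_zero (P : ProjectiveResolution X) {φ : P.complex.X 2 ⟶ Y}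
    {h : P.complex.d 3 2 ≫ φ = 0} (h0 : extClass P φ h = 0) :
    ∃ χ : P.complex.X 1 ⟶ Y, φ = P.complex.d 2 1 ≫ χ := by
  have h1 := (cancel_epi (extTwoIso P Y).hom).1
    ((Quiver.Hom.unop_inj (h0.trans (Limits.unop_zero _ _).symm)).trans comp_zero.symm)
  obtain ⟨χ, hχ⟩ := exists_of_homologyDescTwo_eq_zero h1
  obtain ⟨χ, rfl⟩ := exists_cochainOp_eq P χ
  exact ⟨χ, cochainOp_injective P (hχ.symm.trans (homComplex_d_comp P χ))⟩

lemma extClass_comp_map (P : ProjectiveResolution X) (P' : ProjectiveResolution X')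
    (f : X' ⟶ X) (g : P'.complex ⟶ P.complex) (hg : g.f 0 ≫ P.π.f 0 = P'.π.f 0 ≫ f)
    {φ : P.complex.X 2 ⟶ Y} (h : P.complex.d 3 2 ≫ φ = 0)
    (h' : P'.complex.d 3 2 ≫ g.f 2 ≫ φ = 0) :
    extClass P φ h ≫ ((Ext B (ModuleCat.{u} B) 2).map f.op).app Y =
      extClass P' (g.f 2 ≫ φ) h' := by
  apply Quiver.Hom.op_inj
  have h1 := extTwoIso_hom_naturality (Y := Y) P P' f g hg
  unfold extClass
  rw [op_comp, Quiver.Hom.op_unop, Quiver.Hom.op_unop, reassoc_of% h1,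
    homologyMap_comp_homologyDescTwo]
  exact homComplexMap_comp_cochainOp _ _

lemma smul_extClass (P : ProjectiveResolution X) {φ : P.complex.X 2 ⟶ Y}
    (h : P.complex.d 3 2 ≫ φ = 0) (c : B) (h' : P.complex.d 3 2 ≫ (c • φ) = 0) :
    c • (extClass P φ h).hom (1 : B) = (extClass P (c • φ) h').hom (1 : B) := by
  have h3 : extClass P (c • φ) h' = ModuleCat.ofHom (LinearMap.lsmul B B c) ≫ extClass P φ h := by
    apply Quiver.Hom.op_inj
    unfold extClass
    rw [op_comp, Quiver.Hom.op_unop, Quiver.Hom.op_unop, Category.assoc,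
      homologyDescTwo_comp _ _ _ (cochainOp_smul P φ c)]
  rw [h3, ← map_smul]
  rfl

end ExtTwo

end

section

open CategoryTheory Limits Opposite

/-! ### Linear algebra for comparison with Koszul complexes. -/

section Koszul

variable {B : Type u} [CommRing B]

/-- In a Noetherian ring, the powers of an element have pro-zero Koszul homology modulo `z`. -/
lemma exists_dvd_mul_pow_of_dvd_mul_pow [IsNoetherianRing B] (x z : B) :
    ∃ k : ℕ, ∀ (n : ℕ) (p : B), z ∣ p * x ^ n → z ∣ p * x ^ k := by
  -- The ascending chain of colon ideals (z : xⁿ) stabilizes.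
  let f : ℕ →o Ideal B :=
    { toFun := fun n => Submodule.comap (LinearMap.mulRight B (x ^ n)) (Ideal.span {z})
      monotone' := by
        intro i j hij p hp
        simp only [Submodule.mem_comap, LinearMap.mulRight_apply, Ideal.mem_span_singleton] at hp ⊢
        rw [← Nat.add_sub_cancel' hij, pow_add, ← mul_assoc]
        exact hp.mul_right _ }
  obtain ⟨k, hk⟩ := monotone_stabilizes_iff_noetherian.2 (inferInstance : IsNoetherian B B) f
  have hf : ∀ n p, p ∈ f n ↔ z ∣ p * x ^ n := by
    intro n p
    exact Ideal.mem_span_singleton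
  refine ⟨k, fun n p h => ?_⟩
  rw [← hf] at h ⊢
  rcases le_total n k with h1 | h1
  · exact f.monotone h1 h
  · rw [hk n h1]
    exact h

lemma exists_linearMap_mul_eq {M : Type*} [AddCommGroup M] [Module B M] {z : B}
    (hz : z ∈ nonZeroDivisors B) (α : M →ₗ[B] B) (h : ∀ w, z ∣ α w) :
    ∃ e : M →ₗ[B] B, ∀ w, z * e w = α w := by
  choose e he using h
  refine ⟨⟨⟨e, fun v w => ?_⟩, fun c w => ?_⟩, fun w => (he w).symm⟩
  · apply (mul_cancel_left_mem_nonZeroDivisors hz).1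
    rw [← he, mul_add, ← he, ← he, map_add]
  · apply (mul_cancel_left_mem_nonZeroDivisors hz).1
    rw [← he, map_smul, he w, smul_eq_mul, smul_eq_mul, RingHom.id_apply]
    ring

lemma exists_linearMap_of_mem_span_pair {M : Type*} [AddCommGroup M] [Module B M]
    [Module.Projective B M] {s t : B} (α : M →ₗ[B] B) (h : ∀ w, α w ∈ Ideal.span {s, t}) :
    ∃ β γ : M →ₗ[B] B, ∀ w, α w = β w * s + γ w * t := by
  let F : B × B →ₗ[B] Ideal.span {s, t} :=
    LinearMap.codRestrict (Ideal.span {s, t})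
      ((LinearMap.mulRight B s).coprod (LinearMap.mulRight B t)) (fun p =>
        Ideal.mem_span_pair.2 ⟨p.1, p.2, rfl⟩)
  have hF : Function.Surjective F := by
    rintro ⟨w, hw⟩
    obtain ⟨p, q, hpq⟩ := Ideal.mem_span_pair.1 hw
    exact ⟨(p, q), Subtype.ext hpq⟩
  obtain ⟨g, hg⟩ := Module.projective_lifting_property F (LinearMap.codRestrict _ α h) hF
  refine ⟨LinearMap.fst B B B ∘ₗ g, LinearMap.snd B B B ∘ₗ g, fun w => ?_⟩
  exact (congr_arg Subtype.val (LinearMap.congr_fun hg w)).symm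

end Koszul

namespace CategoryTheory.ProjectiveResolution

variable {B : Type u} [CommRing B] {X : ModuleCat.{u} B} (P : ProjectiveResolution X)

/-- The augmentation of a projective resolution of a module, as a linear map. -/
noncomputable def augmentation : P.complex.X 0 →ₗ[B] X := (P.π.f 0).hom

lemma augmentation_surjective : Function.Surjective P.augmentation :=
  (ModuleCat.epi_iff_surjective (P.π.f 0)).1 inferInstance

lemma augmentation_d (w : P.complex.X 1) : P.augmentation ((P.complex.d 1 0).hom w) = 0 :=
  LinearMap.congr_fun (congr_arg ModuleCat.Hom.hom P.complex_d_comp_π_f_zero) w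

lemma exists_d_eq_of_augmentation_eq_zero {z : P.complex.X 0} (hz : P.augmentation z = 0) :
    ∃ w, (P.complex.d 1 0).hom w = z :=
  (ShortComplex.moduleCat_exact_iff _).1 P.exact₀ z hz

lemma exists_d_eq_of_d_eq_zero {z : P.complex.X 1} (hz : (P.complex.d 1 0).hom z = 0) :
    ∃ w, (P.complex.d 2 1).hom w = z :=
  (ShortComplex.moduleCat_exact_iff _).1 (P.exact_succ 0) z hz

lemma d_d_apply (i j k : ℕ) (z : P.complex.X i) :
    (P.complex.d j k).hom ((P.complex.d i j).hom z) = 0 :=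
  LinearMap.congr_fun (congr_arg ModuleCat.Hom.hom (P.complex.d_comp_d i j k)) z

instance module_projective (i : ℕ) : Module.Projective B (P.complex.X i) :=
  (IsProjective.iff_projective _).2 (P.projective i)

end CategoryTheory.ProjectiveResolution

/-! ### Classes in H² over a Noetherian ring with x, y nonzerodivisors. -/

section LocalCohomology

variable {B : Type u} [CommRing B]

/-- The projection `B/I → B/J` as a morphism in the category of modules. -/
noncomputable abbrev quotientFactor {I J : Ideal B} (h : I ≤ J) :
    ModuleCat.of B (B ⧸ I) ⟶ ModuleCat.of B (B ⧸ J) :=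
  ModuleCat.ofHom (Submodule.mapQ I J LinearMap.id h)

/-- The module `Ext²(B/J, B)`. -/
noncomputable abbrev extTwoQuotient (J : Ideal B) : ModuleCat.{u} B :=
  ((Ext B (ModuleCat.{u} B) 2).obj (op (ModuleCat.of B (B ⧸ J)))).obj (ModuleCat.of B B)

/-- The map `Ext²(B/J, B) → Ext²(B/I, B)` induced by the projection `B/I → B/J`. -/
noncomputable def extTwoRestrict {I J : Ideal B} (h : I ≤ J) :
    extTwoQuotient J →ₗ[B] extTwoQuotient I :=
  (((Ext B (ModuleCat.{u} B) 2).map (quotientFactor h).op).app (ModuleCat.of B B)).hom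

lemma extTwoRestrict_extTwoRestrict {I J K : Ideal B} (h : I ≤ J) (h' : J ≤ K)
    (w : extTwoQuotient K) :
    extTwoRestrict h (extTwoRestrict h' w) = extTwoRestrict (h.trans h') w := by
  have h1 : quotientFactor (h.trans h') = quotientFactor h ≫ quotientFactor h' := by
    ext
    rfl
  unfold extTwoRestrict
  rw [h1, op_comp, Functor.map_comp, NatTrans.comp_app]
  rfl

/-- The canonical map from `Ext²(B/I^s, B)` to local cohomology, and its kernel. -/
lemma exists_extTwo_to_localCohomology (I : Ideal B) (s : ℕ) :
    ∃ ι : extTwoQuotient (I ^ s) →ₗ[B] (localCohomology I 2).obj (ModuleCat.of B B),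
      ∀ w, ι w = 0 → ∃ (t : ℕ) (h : s ≤ t), extTwoRestrict (Ideal.pow_le_pow_right h) w = 0 := by
  let D := localCohomology.diagram (localCohomology.idealPowersDiagram I) 2
  let ev := (evaluation (ModuleCat.{u} B) (ModuleCat.{u} B)).obj (ModuleCat.of B B)
  have hcol : IsColimit (ev.mapCocone (colimit.cocone D)) :=
    isColimitOfPreserves ev (colimit.isColimit D)
  have : PreservesFilteredColimitsOfSize.{0, 0} (forget (ModuleCat.{u} B)) :=
    preservesFilteredColimitsOfSize_shrink.{0, u, 0, u} _
  refine ⟨((ev.mapCocone (colimit.cocone D)).ι.app (op (op s))).hom, fun w hw => ?_⟩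
  obtain ⟨t, f, g, hfg⟩ := Concrete.isColimit_exists_of_rep_eq (D ⋙ ev) hcol (i := op (op s))
    (j := op (op s)) w (0 : extTwoQuotient (I ^ s)) (hw.trans (map_zero _).symm)
  exact ⟨t.unop.unop, leOfHom f.unop.unop, hfg.trans (map_zero _)⟩

/-- For nonzerodivisors `x, y` of a Noetherian ring `B` and `b ∈ B`, a class in
`Ext²(B/(x^m, y^m), B)`, for some `m`, that corresponds to the class of `b` in `B/(xⁿ, yⁿ)`. -/
theorem exists_ext_two_class [IsNoetherianRing B] {x y : B} (hx : x ∈ nonZeroDivisors B)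
    (hy : y ∈ nonZeroDivisors B) (b : B) (n : ℕ) :
    ∃ (m : ℕ) (η : extTwoQuotient (Ideal.span {x ^ m, y ^ m})),
      ∀ c : B, (c * b ∈ Ideal.span {x ^ n, y ^ n} → c • η = 0) ∧
        ∀ (l : ℕ) (J : Ideal B) (hJ : J ≤ Ideal.span {x ^ m, y ^ m}), x ^ (m + l) ∈ J →
          y ^ (m + l) ∈ J →
          extTwoRestrict hJ (c • η) = 0 →
          ∃ j, c * b * (x * y) ^ j ∈ Ideal.span {x ^ (n + j), y ^ (n + j)} := by
  obtain ⟨k, hk⟩ := exists_dvd_mul_pow_of_dvd_mul_pow x (y ^ n)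
  -- A syzygy of (x^(n+k), y^(n+k)) need not be a Koszul one, but it becomes one for (xⁿ, yⁿ) after
  -- its entries are multiplied by x^k and y^k.
  have hdiv : ∀ p q : B, p * x ^ (n + k) + q * y ^ (n + k) = 0 → y ^ n ∣ p * x ^ k := by
    intro p q h
    refine hk (n + k) p ⟨- q * y ^ k, ?_⟩
    linear_combination h
  have hyn : y ^ n ∈ nonZeroDivisors B := pow_mem hy n
  have hxn : x ^ n ∈ nonZeroDivisors B := pow_mem hx n
  set J₀ : Ideal B := Ideal.span {x ^ (n + k), y ^ (n + k)} with hJ₀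
  let P : ProjectiveResolution (ModuleCat.of B (B ⧸ J₀)) := projectiveResolution _
  -- The maps θ, (x^k β, y^k γ) and `e` below form a chain map from `P` to the Koszul complex of
  -- (xⁿ, yⁿ). Pulling back the top cochain `b` along it gives the cocycle `b • e`.
  obtain ⟨θ, hθ⟩ := Module.projective_lifting_property
    (Submodule.mkQ J₀) P.augmentation (Submodule.mkQ_surjective J₀)
  replace hθ : ∀ w, Submodule.Quotient.mk (p := J₀) (θ w) = P.augmentation w :=
    fun w => LinearMap.congr_fun hθ w
  obtain ⟨β, γ, hβγ⟩ := exists_linearMap_of_mem_span_pair (s := x ^ (n + k)) (t := y ^ (n + k))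
    (θ ∘ₗ (P.complex.d 1 0).hom) (fun w => by
      rw [← hJ₀, ← Submodule.Quotient.mk_eq_zero, LinearMap.comp_apply, hθ, P.augmentation_d])
  simp only [LinearMap.comp_apply] at hβγ
  have hcyc : ∀ w, β ((P.complex.d 2 1).hom w) * x ^ (n + k) +
      γ ((P.complex.d 2 1).hom w) * y ^ (n + k) = 0 := by
    intro w
    rw [← hβγ, P.d_d_apply, map_zero]
  obtain ⟨e, he⟩ := exists_linearMap_mul_eq hyn (x ^ k • (β ∘ₗ (P.complex.d 2 1).hom))
    (fun w => by simpa [mul_comm] using hdiv _ _ (hcyc w))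
  simp only [LinearMap.smul_apply, LinearMap.comp_apply, smul_eq_mul] at he
  have he' : ∀ w, x ^ n * e w = - (y ^ k * γ ((P.complex.d 2 1).hom w)) := by
    intro w
    apply (mul_cancel_left_mem_nonZeroDivisors hyn).1
    linear_combination x ^ n * he w + hcyc w
  have hed : ∀ z, e ((P.complex.d 3 2).hom z) = 0 := by
    intro z
    apply (mul_cancel_left_mem_nonZeroDivisors hyn).1
    rw [he, P.d_d_apply]
    simp
  have hφ : ∀ c : B, P.complex.d 3 2 ≫ (ModuleCat.ofHom (c • e) :
      P.complex.X 2 ⟶ ModuleCat.of B B) = 0 := by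
    intro c
    ext z
    exact (congr_arg (c * ·) (hed z)).trans (mul_zero c)
  have hsmul : ∀ c : B, c • (extClass P _ (hφ b)).hom (1 : B) =
      (extClass P _ (hφ (c * b))).hom (1 : B) := by
    intro c
    rw [smul_extClass P (hφ b) c (by rw [Linear.comp_smul, hφ b, smul_zero])]
    congr 3
    rw [mul_smul]
    rfl
  refine ⟨n + k, (extClass P _ (hφ b)).hom (1 : B), fun c => ⟨fun hc => ?_, ?_⟩⟩
  · rw [hsmul]
    obtain ⟨s, t, hst⟩ := Ideal.mem_span_pair.1 hc
    -- If cb = s xⁿ + t yⁿ, then cb is a Koszul coboundary; this is its pullback along the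
    -- comparison map.
    rw [extClass_d_comp P (ModuleCat.ofHom ((t * x ^ k) • β - (s * y ^ k) • γ)) (hφ (c * b))]
    · rfl
    · ext w
      simp only [ModuleCat.hom_comp, ModuleCat.hom_ofHom, LinearMap.comp_apply,
        LinearMap.sub_apply, LinearMap.smul_apply, smul_eq_mul]
      linear_combination - e w * hst + t * he w + s * he' w
  · intro l J hJ hxJ hyJ h0
    rw [hsmul] at h0
    let P' : ProjectiveResolution (ModuleCat.of B (B ⧸ J)) := projectiveResolution _
    let g := ProjectiveResolution.lift (quotientFactor hJ) P' P
    have hg := ProjectiveResolution.lift_commutes_zero (quotientFactor hJ) P' P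
    have hg' : ∀ w, P.augmentation ((g.f 0).hom w) =
        (quotientFactor hJ).hom (P'.augmentation w) := fun w =>
      LinearMap.congr_fun (congr_arg ModuleCat.Hom.hom hg) w
    have hgd : ∀ i j w, (g.f j).hom ((P'.complex.d i j).hom w) =
        (P.complex.d i j).hom ((g.f i).hom w) := fun i j w =>
      (LinearMap.congr_fun (congr_arg ModuleCat.Hom.hom (g.comm i j)) w).symm
    have h' : P'.complex.d 3 2 ≫ g.f 2 ≫ (ModuleCat.ofHom ((c * b) • e) :
        P.complex.X 2 ⟶ ModuleCat.of B B) = 0 := by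
      rw [← HomologicalComplex.Hom.comm_assoc, hφ, comp_zero]
    have h1 : extClass P' _ h' = 0 := by
      rw [← extClass_comp_map P P' (quotientFactor hJ) g hg (hφ (c * b)) h']
      ext
      exact h0
    obtain ⟨χ, hχ⟩ := exists_of_extClass_eq_zero P' h1
    replace hχ : ∀ w, c * b * e ((g.f 2).hom w) = χ.hom ((P'.complex.d 2 1).hom w) := fun w =>
      LinearMap.congr_fun (congr_arg ModuleCat.Hom.hom hχ) w
    -- The elements `p₀`, `px`, `py`, `κ` are the images of the basis of the Koszul complex of
    -- (x^(n+k+l), y^(n+k+l)) under a chain map to `P'`.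
    obtain ⟨p₀, hp₀⟩ := P'.augmentation_surjective (Submodule.Quotient.mk (1 : B))
    have hlift : ∀ s ∈ J, ∃ w, (P'.complex.d 1 0).hom w = s • p₀ := by
      intro s hs
      apply P'.exists_d_eq_of_augmentation_eq_zero
      rw [map_smul, hp₀]
      refine (Submodule.Quotient.mk_eq_zero J).2 ?_
      simpa using hs
    obtain ⟨px, hpx⟩ := hlift _ hxJ
    obtain ⟨py, hpy⟩ := hlift _ hyJ
    obtain ⟨κ, hκ⟩ := P'.exists_d_eq_of_d_eq_zero
      (z := y ^ (n + k + l) • px - x ^ (n + k + l) • py) (by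
        rw [map_sub, map_smul, map_smul, hpx, hpy, smul_smul, smul_smul, mul_comm, sub_self])
    -- `G` is the degree 0 component of the composite of Koszul complexes through `P'` and `P`; it
    -- is 1 only modulo `J₀`.
    obtain ⟨G, hG⟩ : ∃ G, θ ((g.f 0).hom p₀) = G := ⟨_, rfl⟩
    have hG1 : G - 1 ∈ J₀ := by
      rw [← Submodule.Quotient.eq J₀, ← hG, hθ, hg', hp₀]
      rfl
    obtain ⟨s, t, hst⟩ := Ideal.mem_span_pair.1 hG1
    have hA := hβγ ((g.f 1).hom px)
    have hB := hβγ ((g.f 1).hom py)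
    rw [← hgd, hpx, map_smul, map_smul, hG, smul_eq_mul] at hA
    rw [← hgd, hpy, map_smul, map_smul, hG, smul_eq_mul] at hB
    have hε := he ((g.f 2).hom κ)
    rw [← hgd, hκ, map_sub, map_sub, map_smul, map_smul, map_smul, map_smul, smul_eq_mul,
      smul_eq_mul] at hε
    have hχκ := hχ κ
    rw [hκ, map_sub, map_smul, map_smul, smul_eq_mul, smul_eq_mul] at hχκ
    generalize β ((g.f 1).hom px) = a₁ at *
    generalize γ ((g.f 1).hom px) = a₂ at *
    generalize β ((g.f 1).hom py) = b₁ at *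
    generalize γ ((g.f 1).hom py) = b₂ at *
    generalize e ((g.f 2).hom κ) = ε at *
    generalize (χ.hom px : B) = c₁ at *
    generalize (χ.hom py : B) = c₂ at *
    obtain ⟨e₁, he₁⟩ := hdiv (a₁ - x ^ l * G) a₂ (by linear_combination - hA)
    obtain ⟨e₂, he₂⟩ := hdiv b₁ (b₂ - y ^ l * G) (by linear_combination - hB)
    -- The degree 2 component of the composite is the standard (xy)^(k+l), up to the factor `G` and
    -- a multiple of x^(n+k+l) and y^(n+k+l). Hence j = k + l below.
    have hε' : ε = y ^ (n + k + l) * e₁ + (x * y) ^ (k + l) * G - x ^ (n + k + l) * e₂ := by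
      apply (mul_cancel_left_mem_nonZeroDivisors hyn).1
      linear_combination hε + y ^ (n + k + l) * he₁ - x ^ (n + k + l) * he₂
    refine ⟨k + l, Ideal.mem_span_pair.2 ⟨c * b * e₂ - c₂ - c * b * s * x ^ k * y ^ (k + l),
      c₁ - c * b * e₁ - c * b * t * x ^ (k + l) * y ^ k, ?_⟩⟩
    subst hε'
    linear_combination - hχκ - c * b * (x * y) ^ (k + l) * hst

/-- For nonzerodivisors `x, y` of a Noetherian ring `B` and `b ∈ B`, the class
`[b/(xy)ⁿ]` in `H²_{(x, y)}(B)`, characterized through its annihilator. -/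
theorem exists_localCohomology_class [IsNoetherianRing B] {x y : B} (hx : x ∈ nonZeroDivisors B)
    (hy : y ∈ nonZeroDivisors B) (b : B) (n : ℕ) :
    ∃ η : (localCohomology (Ideal.span {x, y}) 2).obj (ModuleCat.of B B),
      ∀ c : B, (c * b ∈ Ideal.span {x ^ n, y ^ n} → c • η = 0) ∧
        (c • η = 0 → ∃ j, c * b * (x * y) ^ j ∈ Ideal.span {x ^ (n + j), y ^ (n + j)}) := by
  obtain ⟨m, η, hη⟩ := exists_ext_two_class hx hy b n
  set I : Ideal B := Ideal.span {x, y} with hI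
  have hxI : x ∈ I := Ideal.subset_span (by simp)
  have hyI : y ∈ I := Ideal.subset_span (by simp)
  obtain ⟨s, hs⟩ : ∃ s, I ^ s ≤ Ideal.span {x ^ m, y ^ m} := by
    refine Ideal.exists_pow_le_of_le_radical_of_fg ?_ (IsNoetherian.noetherian I)
    rw [hI, Ideal.span_le]
    rintro z (rfl | rfl)
    · exact ⟨m, Ideal.subset_span (by simp)⟩
    · exact ⟨m, Ideal.subset_span (by simp)⟩
  -- The exponent s + m instead of s guarantees that every later t has the form m + l, so that
  -- x^(m+l) and y^(m+l) lie in `I ^ t`.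
  have hpow : I ^ (s + m) ≤ Ideal.span {x ^ m, y ^ m} :=
    (Ideal.pow_le_pow_right (Nat.le_add_right s m)).trans hs
  obtain ⟨ι, hι⟩ := exists_extTwo_to_localCohomology I (s + m)
  refine ⟨ι (extTwoRestrict hpow η), fun c => ⟨fun h => ?_, fun h => ?_⟩⟩
  · rw [← map_smul, ← map_smul, (hη c).1 h, map_zero, map_zero]
  · rw [← map_smul, ← map_smul] at h
    obtain ⟨t, hle, ht⟩ := hι _ h
    rw [extTwoRestrict_extTwoRestrict] at ht
    obtain ⟨l, rfl⟩ := Nat.exists_eq_add_of_le ((Nat.le_add_left m s).trans hle)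
    exact (hη c).2 l _ _ (Ideal.pow_mem_pow hxI _) (Ideal.pow_mem_pow hyI _) ht

end LocalCohomology

end

/-! ### Minimal primes of a determinant and the cokernel. -/

section Cokernel

variable {A₀ : Type*} [CommRing A₀]

/-- A minimal prime of the determinant of a square matrix over a Noetherian ring is the annihilator
of an element of the cokernel. -/
lemma exists_vector_of_mem_minimalPrimes_det [IsNoetherianRing A₀] {N : ℕ}
    (M : Matrix (Fin N) (Fin N) A₀) {P : Ideal A₀}
    (hP : P ∈ (Ideal.span {M.det}).minimalPrimes) :
    ∃ v : Fin N → A₀, ∀ c, c ∈ P ↔ ∃ w, M.mulVec w = c • v := by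
  let L := LinearMap.range M.mulVecLin
  have hrad : (Module.annihilator A₀ ((Fin N → A₀) ⧸ L)).radical =
      (Ideal.span {M.det}).radical := by
    apply le_antisymm
    · rw [Ideal.radical_le_radical_iff]
      intro c hc
      rw [Submodule.annihilator_quotient, Submodule.mem_colon] at hc
      have h1 : ∀ j, ∃ w, M.mulVec w = c • (Pi.single j 1 : Fin N → A₀) := fun j =>
        hc _ (Set.mem_univ _)
      choose w hw using h1
      -- If c kills the cokernel, then c times the identity factors through M, and taking
      -- determinants gives det M ∣ c^N. Conversely, the adjugate shows that det M kills the
      -- cokernel.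
      have h2 : M * (Matrix.of w).transpose = c • (1 : Matrix (Fin N) (Fin N) A₀) := by
        ext i j
        have := congr_fun (hw j) i
        simpa [Matrix.mul_apply, Matrix.mulVec, dotProduct, Matrix.one_apply, Pi.single_apply]
          using this
      refine ⟨N, Ideal.mem_span_singleton.2 ⟨(Matrix.of w).transpose.det, ?_⟩⟩
      rw [← Matrix.det_mul, h2, Matrix.det_smul]
      simp
    · rw [Ideal.radical_le_radical_iff, Ideal.span_singleton_le_iff_mem]
      apply Ideal.le_radical
      rw [Submodule.annihilator_quotient, Submodule.mem_colon]
      intro v _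
      refine ⟨M.adjugate.mulVec v, ?_⟩
      rw [Matrix.mulVecLin_apply, Matrix.mulVec_mulVec, Matrix.mul_adjugate, Matrix.smul_mulVec,
        Matrix.one_mulVec]
  rw [← Ideal.radical_minimalPrimes, ← hrad, Ideal.radical_minimalPrimes] at hP
  have hass := Module.associatedPrimes.minimalPrimes_annihilator_subset_associatedPrimes A₀
    ((Fin N → A₀) ⧸ L) hP
  obtain ⟨-, v, hv⟩ := isAssociatedPrime_iff.1 hass
  obtain ⟨v, rfl⟩ := Submodule.Quotient.mk_surjective _ v
  refine ⟨v, fun c => ?_⟩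
  rw [hv, Submodule.mem_colon_singleton, Submodule.mem_bot, ← Submodule.Quotient.mk_smul,
    Submodule.Quotient.mk_eq_zero]
  rfl

end Cokernel

/-! ### Moving an annihilator into the socle. -/

section Socle

variable {A₀ T : Type*} [CommRing A₀] [CommRing T] [Algebra A₀ T]

/-- Take the least exponent for which some scalar s outside P sends s l^(i+1) z into J. Then g = s
l^i works: by minimality, no scalar outside P kills g z. It is applied to l = x and then to l = y.
-/
lemma exists_mul_mem_of_pow_mem {J : Ideal T} {P : Ideal A₀} (hP : P.IsPrime) {l z : T} {n : ℕ}
    (hl : l ^ n ∈ J) (hz : ∀ c, algebraMap A₀ T c * z ∈ J ↔ c ∈ P) :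
    ∃ g, (∀ c, algebraMap A₀ T c * (g * z) ∈ J ↔ c ∈ P) ∧ l * (g * z) ∈ J := by
  classical
  have hex : ∃ i, ∃ c, c ∉ P ∧ algebraMap A₀ T c * (l ^ i * z) ∈ J :=
    ⟨n, 1, P.ne_top_iff_one.1 hP.ne_top,
      J.mul_mem_left _ (J.mul_mem_right _ hl)⟩
  obtain ⟨s, hs, hsJ⟩ := Nat.find_spec hex
  have hmin := fun i => Nat.find_min hex (m := i)
  obtain ⟨i, hi⟩ : ∃ i, Nat.find hex = i + 1 := by
    refine Nat.exists_eq_succ_of_ne_zero fun h0 => ?_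
    rw [h0, pow_zero, one_mul, hz] at hsJ
    exact hs hsJ
  rw [hi] at hsJ
  refine ⟨algebraMap A₀ T s * l ^ i, fun c => ⟨fun h => ?_, fun h => ?_⟩, ?_⟩
  · by_contra hc
    refine hmin i (by omega) ⟨c * s, fun hcs => (hP.mem_or_mem hcs).elim hc hs, ?_⟩
    rw [map_mul]
    convert h using 1
    ring
  · convert J.mul_mem_left (algebraMap A₀ T s * l ^ i) ((hz c).2 h) using 1
    ring
  · convert hsJ using 1
    ring

end Socle

/-! ### The graded piece of A₀[x, y]/(xⁿ, yⁿ, F) presented by the Toeplitz matrix. -/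

namespace BinaryPolynomial

open MvPolynomial


variable {A₀ : Type*} [CommRing A₀]

/-- The exponent of the monomial `x^p y^q`. -/
noncomputable def expo (p q : ℕ) : Fin 2 →₀ ℕ := Finsupp.single 0 p + Finsupp.single 1 q

@[simp] lemma expo_zero (p q : ℕ) : expo p q 0 = p := by simp [expo]

@[simp] lemma expo_one (p q : ℕ) : expo p q 1 = q := by simp [expo]

lemma expo_le_iff {p q : ℕ} {s : Fin 2 →₀ ℕ} : expo p q ≤ s ↔ p ≤ s 0 ∧ q ≤ s 1 := by
  rw [Finsupp.le_def, Fin.forall_fin_two, expo_zero, expo_one]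

lemma finsupp_ext {s t : Fin 2 →₀ ℕ} (h0 : s 0 = t 0) (h1 : s 1 = t 1) : s = t := by
  ext i
  fin_cases i
  · exact h0
  · exact h1

lemma expo_eq_iff {p q p' q' : ℕ} : expo p q = expo p' q' ↔ p = p' ∧ q = q' := by
  refine ⟨fun h => ⟨?_, ?_⟩, fun h => by rw [h.1, h.2]⟩
  · simpa using DFunLike.congr_fun h 0
  · simpa using DFunLike.congr_fun h 1

lemma expo_sub (p q p' q' : ℕ) : expo p q - expo p' q' = expo (p - p') (q - q') :=
  finsupp_ext (by simp) (by simp)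

lemma monomial_expo (p q : ℕ) (c : A₀) :
    monomial (expo p q) c = C c * (X 0 ^ p * X 1 ^ q) := by
  rw [X_pow_eq_monomial, X_pow_eq_monomial, monomial_mul, C_mul_monomial, expo, one_mul, mul_one]

lemma coeff_monomial_expo_mul (p q p' q' : ℕ) (c : A₀) (g : MvPolynomial (Fin 2) A₀) :
    coeff (expo p q) (monomial (expo p' q') c * g) =
      if p' ≤ p ∧ q' ≤ q then c * coeff (expo (p - p') (q - q')) g else 0 := by
  rw [coeff_monomial_mul', expo_sub]
  simp only [expo_le_iff, expo_zero, expo_one]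

lemma mem_span_X_pow_iff {n : ℕ} {g : MvPolynomial (Fin 2) A₀} :
    g ∈ Ideal.span {X 0 ^ n, X 1 ^ n} ↔ ∀ p q, p < n → q < n → coeff (expo p q) g = 0 := by
  have h : ({X 0 ^ n, X 1 ^ n} : Set (MvPolynomial (Fin 2) A₀)) =
      (fun s => monomial s 1) '' {expo n 0, expo 0 n} := by
    rw [Set.image_pair, monomial_expo, monomial_expo]
    simp
  rw [h, mem_ideal_span_monomial_image]
  constructor
  · intro H p q hp hq
    by_contra hne
    obtain ⟨t, ht, hle⟩ := H _ (mem_support_iff.2 hne)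
    rcases ht with rfl | rfl
    · simp only [expo_le_iff, expo_zero] at hle
      omega
    · simp only [expo_le_iff, expo_one] at hle
      omega
  · intro H s hs
    by_cases h0 : n ≤ s 0
    · exact ⟨_, Or.inl rfl, expo_le_iff.2 ⟨h0, Nat.zero_le _⟩⟩
    by_cases h1 : n ≤ s 1
    · exact ⟨_, Or.inr rfl, expo_le_iff.2 ⟨Nat.zero_le _, h1⟩⟩
    refine absurd ?_ (mem_support_iff.1 hs)
    rw [← H (s 0) (s 1) (by omega) (by omega)]
    congr 1
    exact finsupp_ext (by simp) (by simp)

variable {d : ℕ} (r : Fin (d + 1) → A₀) (a : ℕ)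

/-- The form `(xy)^a (r₀ x^d + ⋯ + r_d y^d)`. -/
noncomputable abbrev form : MvPolynomial (Fin 2) A₀ := (X 0 * X 1) ^ a * binaryForm r (X 0) (X 1)

lemma form_eq_sum : form r a =
    ∑ i : Fin (d + 1), monomial (expo (a + (d - i)) (a + i)) (r i) := by
  rw [form, binaryForm, Finset.mul_sum]
  refine Finset.sum_congr rfl fun i _ => ?_
  rw [monomial_expo, algebraMap_eq]
  ring

lemma coeff_form_mul (g : MvPolynomial (Fin 2) A₀) (p q : ℕ) :
    coeff (expo p q) (form r a * g) = ∑ i : Fin (d + 1),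
      if a + (d - i) ≤ p ∧ a + i ≤ q then
        r i * coeff (expo (p - (a + (d - i))) (q - (a + i))) g else 0 := by
  rw [form_eq_sum, Finset.sum_mul, coeff_sum]
  exact Finset.sum_congr rfl fun i _ => coeff_monomial_expo_mul _ _ _ _ _ _

/-- In the degree for which the presentation matrix is square, the multiplication by the form is
given by the multidiagonal matrix. -/
lemma coeff_form_mul_eq_mulVec (hd : Even d) {N : ℕ} (g : MvPolynomial (Fin 2) A₀) (k : Fin N) :
    coeff (expo (a + d / 2 + (N - 1 - k)) (a + d / 2 + k)) (form r a * g) =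
      (multidiagonal r N).mulVec (fun l => coeff (expo (N - 1 - l) l) g) k := by
  have hd2 : d % 2 = 0 := Nat.even_iff.1 hd
  have hk := k.2
  rw [coeff_form_mul]
  simp only [Matrix.mulVec, dotProduct, multidiagonal, Matrix.of_apply, dite_mul, zero_mul]
  rw [← Finset.sum_filter, Finset.sum_dite, Finset.sum_const_zero, add_zero]
  -- The i-th term of the form sends column l to row k exactly when i + l = d/2 + k, so i ↦ d/2 + k
  -- − i matches the nonzero summands on both sides.
  refine Finset.sum_bij'
    (i := fun i hi => ⟨⟨d / 2 + k - i, ?_⟩, ?_⟩)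
    (j := fun l hl => ⟨d / 2 + k - (l.1 : ℕ), ?_⟩) ?_ ?_ ?_ ?_ ?_
  · have := (Finset.mem_filter.1 hi).2
    have := i.2
    omega
  · have := (Finset.mem_filter.1 hi).2
    have := i.2
    simp only [Finset.mem_filter, Finset.mem_univ, true_and]
    omega
  · exact (Finset.mem_filter.1 l.2).2.2
  · intro i hi
    exact Finset.mem_attach _ _
  · intro l hl
    have := (Finset.mem_filter.1 l.2).2
    have := l.1.2
    simp only [Finset.mem_filter, Finset.mem_univ, true_and]
    omega
  · intro i hi
    have := (Finset.mem_filter.1 hi).2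
    apply Fin.ext
    simp only
    omega
  · intro l hl
    have := (Finset.mem_filter.1 l.2).2
    apply Subtype.ext
    apply Fin.ext
    simp only
    omega
  · intro i hi
    have := (Finset.mem_filter.1 hi).2
    have := i.2
    have h1 : d / 2 + k - (d / 2 + k - i) = (i : ℕ) := by omega
    refine congr_arg₂ (· * ·) (congr_arg r (Fin.ext h1.symm))
      (congr_arg (fun s => coeff s g) (expo_eq_iff.2 ?_))
    simp only
    omega

variable (n : ℕ)

/-- The ideal `(xⁿ, yⁿ, (xy)^a (r₀ x^d + ⋯ + r_d y^d))`. -/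
noncomputable abbrev truncIdeal : Ideal (MvPolynomial (Fin 2) A₀) :=
  Ideal.span {X 0 ^ n, X 1 ^ n} ⊔ Ideal.span {form r a}

/-- Comparing coefficients in total degree N + 2a + d − 1 identifies membership of `C c * z` with
solvability of M w = c v; `z` has the entries of `v` as coefficients. -/
lemma exists_annihilator_truncIdeal [IsNoetherianRing A₀] (hd : Even d) {N : ℕ} {P : Ideal A₀}
    (hP : P ∈ (Ideal.span {(multidiagonal r N).det}).minimalPrimes) :
    ∃ z, ∀ c, C c * z ∈ truncIdeal r a (N + a + d / 2) ↔ c ∈ P := by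
  obtain ⟨v, hv⟩ := exists_vector_of_mem_minimalPrimes_det _ hP
  have hd2 : d % 2 = 0 := Nat.even_iff.1 hd
  let z : MvPolynomial (Fin 2) A₀ :=
    ∑ k : Fin N, monomial (expo (a + d / 2 + (N - 1 - k)) (a + d / 2 + k)) (v k)
  have hz : ∀ k : Fin N, coeff (expo (a + d / 2 + (N - 1 - k)) (a + d / 2 + k)) z = v k := by
    intro k
    rw [coeff_sum, Finset.sum_eq_single k]
    · rw [coeff_monomial, if_pos rfl]
    · intro l _ hl
      rw [coeff_monomial, if_neg]
      rw [expo_eq_iff]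
      have : (l : ℕ) ≠ k := fun h => hl (Fin.ext h)
      omega
    · intro h
      exact absurd (Finset.mem_univ _) h
  refine ⟨z, fun c => ?_⟩
  rw [hv]
  constructor
  · intro h
    obtain ⟨g₁, hg₁, g₂, hg₂, hsum⟩ := Submodule.mem_sup.1 h
    obtain ⟨g, rfl⟩ := Ideal.mem_span_singleton.1 hg₂
    refine ⟨fun l => coeff (expo (N - 1 - l) l) g, ?_⟩
    ext k
    have hk := k.2
    rw [← coeff_form_mul_eq_mulVec r a hd, Pi.smul_apply, ← hz k, smul_eq_mul, ← coeff_C_mul,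
      ← hsum, coeff_add, mem_span_X_pow_iff.1 hg₁ _ _ (by omega) (by omega), zero_add]
  · rintro ⟨w, hw⟩
    let g : MvPolynomial (Fin 2) A₀ := ∑ l : Fin N, monomial (expo (N - 1 - l) l) (w l)
    have hg : ∀ l : Fin N, coeff (expo (N - 1 - l) l) g = w l := by
      intro l
      rw [coeff_sum, Finset.sum_eq_single l]
      · rw [coeff_monomial, if_pos rfl]
      · intro k _ hk
        rw [coeff_monomial, if_neg]
        rw [expo_eq_iff]
        exact fun h => hk (Fin.ext h.2)
      · intro h
        exact absurd (Finset.mem_univ _) h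
    have hg0 : ∀ p q, p + q + 1 ≠ N → coeff (expo p q) g = 0 := by
      intro p q hpq
      rw [coeff_sum]
      refine Finset.sum_eq_zero fun l _ => ?_
      rw [coeff_monomial, if_neg]
      rw [expo_eq_iff]
      have := l.2
      omega
    refine Submodule.mem_sup.2 ⟨C c * z - form r a * g, ?_, form r a * g,
      Ideal.mul_mem_right _ _ (Ideal.mem_span_singleton_self _), sub_add_cancel _ _⟩
    rw [mem_span_X_pow_iff]
    intro p q hp hq
    rw [coeff_sub, coeff_C_mul]
    -- In this degree the bounds p, q < n leave precisely the N row monomials. In any other degree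
    -- both terms have zero coefficient.
    by_cases hpq : p + q + 1 = N + 2 * a + d
    · obtain ⟨k, rfl, rfl⟩ : ∃ k : Fin N, p = a + d / 2 + (N - 1 - k) ∧ q = a + d / 2 + k :=
        ⟨⟨q - (a + d / 2), by omega⟩, by simp only; omega, by simp only; omega⟩
      rw [hz, coeff_form_mul_eq_mulVec r a hd]
      simp only [hg]
      have := congr_fun hw k
      rw [this, Pi.smul_apply, smul_eq_mul, sub_self]
    · rw [coeff_form_mul, coeff_sum, Finset.sum_eq_zero, Finset.sum_eq_zero]
      · simp
      · intro i _
        have := i.2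
        split_ifs with h
        · rw [hg0 _ _ (by omega), mul_zero]
        · rfl
      · intro k _
        have := k.2
        rw [coeff_monomial, if_neg]
        rw [expo_eq_iff]
        omega

lemma exists_C_add_mul_X (g : MvPolynomial (Fin 2) A₀) :
    ∃ g₀ g₁, g = C (constantCoeff g) + g₀ * X 0 + g₁ * X 1 := by
  have h : g - C (constantCoeff g) ∈
      Ideal.span {(X 0 : MvPolynomial (Fin 2) A₀) ^ 1, X 1 ^ 1} := by
    rw [mem_span_X_pow_iff]
    intro p q hp hq
    obtain rfl : p = 0 := by omega
    obtain rfl : q = 0 := by omega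
    have : expo 0 0 = 0 := by simp [expo]
    rw [this]
    simp [constantCoeff_eq]
  rw [pow_one, pow_one] at h
  obtain ⟨g₀, g₁, hg⟩ := Ideal.mem_span_pair.1 h
  exact ⟨g₀, g₁, by linear_combination - hg⟩

/-- For a minimal prime `P` of the determinant of a multidiagonal matrix, there is an element of
`A₀[x, y]/(xⁿ, yⁿ, (xy)^a (r₀ x^d + ⋯ + r_d y^d))` whose annihilator is `P + (x, y)`. -/
theorem exists_annihilator_eq [IsNoetherianRing A₀] (hd : Even d) {N : ℕ} {P : Ideal A₀}
    (hP : P ∈ (Ideal.span {(multidiagonal r N).det}).minimalPrimes) :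
    ∃ w, ∀ g, g * w ∈ truncIdeal r a (N + a + d / 2) ↔ constantCoeff g ∈ P := by
  obtain ⟨z, hz⟩ := exists_annihilator_truncIdeal r a hd hP
  set J := truncIdeal r a (N + a + d / 2) with hJ
  have hPp : P.IsPrime := hP.isPrime
  have h0 : (X 0 ^ (N + a + d / 2) : MvPolynomial (Fin 2) A₀) ∈ J :=
    Ideal.mem_sup_left (Ideal.subset_span (by simp))
  have h1 : (X 1 ^ (N + a + d / 2) : MvPolynomial (Fin 2) A₀) ∈ J :=
    Ideal.mem_sup_left (Ideal.subset_span (by simp))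
  obtain ⟨g₀, hg₀, hX₀⟩ := exists_mul_mem_of_pow_mem hPp h0 hz
  obtain ⟨g₁, hg₁, hX₁⟩ := exists_mul_mem_of_pow_mem hPp h1 hg₀
  refine ⟨g₁ * (g₀ * z), fun g => ?_⟩
  obtain ⟨f₀, f₁, hf⟩ := exists_C_add_mul_X g
  have hsum : g * (g₁ * (g₀ * z)) = C (constantCoeff g) * (g₁ * (g₀ * z)) +
      (f₀ * g₁ * (X 0 * (g₀ * z)) + f₁ * (X 1 * (g₁ * (g₀ * z)))) := by
    linear_combination (g₁ * (g₀ * z)) * hf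
  rw [hsum, Ideal.add_mem_iff_left J (J.add_mem (J.mul_mem_left _ hX₀) (J.mul_mem_left _ hX₁))]
  exact hg₁ _

end BinaryPolynomial

/-! ### Associated primes over a given prime of the base ring. -/

section Contraction

variable {A₀ B M : Type*} [CommRing A₀] [CommRing B] [IsNoetherianRing B] [Algebra A₀ B]
  [AddCommGroup M] [Module B M]

/-- A prime that is the annihilator over `A₀` of an element of a `B`-module is the contraction of an
associated prime over `B`. -/
theorem exists_mem_associatedPrimes_comap_eq {P : Ideal A₀} (hP : P.IsPrime) (η : M)
    (hη : ∀ c, algebraMap A₀ B c • η = 0 ↔ c ∈ P) :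
    ∃ Q ∈ associatedPrimes B M, Q.comap (algebraMap A₀ B) = P := by
  let F : Set (Ideal B) := {Q | ∃ b : B, Q = LinearMap.ker (LinearMap.toSpanSingleton B M (b • η)) ∧
    Q.comap (algebraMap A₀ B) = P}
  have hmem : ∀ b g : B, g ∈ LinearMap.ker (LinearMap.toSpanSingleton B M (b • η)) ↔
      (g * b) • η = 0 := by
    intro b g
    rw [LinearMap.mem_ker, LinearMap.toSpanSingleton_apply, mul_smul]
  have hF : F.Nonempty := ⟨_, 1, rfl, by
    ext c
    rw [Ideal.mem_comap, hmem, mul_one, hη]⟩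
  -- `Q` is maximal among annihilators of multiples of η that contract to P. Such a `Q` turns out to
  -- be prime.
  obtain ⟨Q, ⟨b, hQ, hQP⟩, hmax⟩ : ∃ Q ∈ F, ∀ I ∈ F, ¬ Q < I :=
    set_has_maximal_iff_noetherian.2 (inferInstance : IsNoetherian B B) F hF
  have hQmem : ∀ g, g ∈ Q ↔ (g * b) • η = 0 := fun g => by rw [hQ, hmem]
  have hcP : ∀ c, algebraMap A₀ B c ∈ Q ↔ c ∈ P := fun c => by rw [← hQP, Ideal.mem_comap]
  -- The annihilator of s b η contains `Q` and still contracts to P, so maximality makes it equal to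
  -- `Q`.
  have hs : ∀ s, s ∉ P → ∀ g, g * algebraMap A₀ B s ∈ Q → g ∈ Q := by
    intro s hsP g hg
    by_contra hgQ
    refine hmax (LinearMap.ker (LinearMap.toSpanSingleton B M ((algebraMap A₀ B s * b) • η)))
      ⟨_, rfl, ?_⟩ (lt_of_le_of_ne ?_ ?_)
    · ext c
      rw [Ideal.mem_comap, hmem, ← mul_assoc, ← hQmem, ← map_mul, hcP]
      exact ⟨fun h => (hP.mem_or_mem h).resolve_right hsP, fun h => P.mul_mem_right _ h⟩
    · intro f hf
      rw [hmem, ← mul_assoc, ← hQmem]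
      exact Q.mul_mem_right _ hf
    · intro h
      apply hgQ
      rw [h, hmem, ← mul_assoc, ← hQmem]
      exact hg
  have hQne : Q ≠ ⊤ := by
    intro h
    apply hP.ne_top
    rw [← hQP, h, Ideal.comap_top]
  have hQprime : Q.IsPrime := by
    refine ⟨hQne, fun {f g} hfg => ?_⟩
    by_contra! hne
    -- The annihilator of g b η strictly contains `Q`, since it contains f; by maximality it
    -- contracts to something larger than P.
    have key : ∃ c, c ∉ P ∧ algebraMap A₀ B c * g ∈ Q := by
      by_contra! hc
      refine hmax (LinearMap.ker (LinearMap.toSpanSingleton B M ((g * b) • η)))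
        ⟨_, rfl, ?_⟩ (lt_of_le_of_ne ?_ ?_)
      · ext c
        rw [Ideal.mem_comap, hmem, ← mul_assoc, ← hQmem]
        exact ⟨fun h => by_contra fun h' => hc c h' h,
          fun h => Q.mul_mem_right _ ((hcP c).2 h)⟩
      · intro t ht
        rw [hmem, ← mul_assoc, ← hQmem]
        exact Q.mul_mem_right _ ht
      · intro h
        apply hne.1
        rw [h, hmem, ← mul_assoc, ← hQmem]
        exact hfg
    obtain ⟨c, hc, hcg⟩ := key
    exact hne.2 (hs c hc g (by rwa [mul_comm]))
  refine ⟨Q, isAssociatedPrime_iff.2 ⟨hQprime, b • η, ?_⟩, hQP⟩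
  ext g
  rw [hQmem, Submodule.mem_colon_singleton, Submodule.mem_bot, mul_smul]

end Contraction

section

open MvPolynomial

/-! ### Evaluation at the origin and localizations of a hypersurface. -/

section Hypersurface

variable {σ A₀ : Type*} [CommRing A₀] {f : MvPolynomial σ A₀}

/-- The evaluation at the origin of a hypersurface through the origin. -/
noncomputable def evalOrigin (hf : constantCoeff f = 0) :
    MvPolynomial σ A₀ ⧸ Ideal.span {f} →+* A₀ :=
  Ideal.Quotient.lift _ constantCoeff fun g hg => by
    obtain ⟨k, rfl⟩ := Ideal.mem_span_singleton.1 hg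
    rw [map_mul, hf, zero_mul]

lemma evalOrigin_mk (hf : constantCoeff f = 0) (g : MvPolynomial σ A₀) :
    evalOrigin hf (Ideal.Quotient.mk _ g) = constantCoeff g := rfl

lemma evalOrigin_surjective (hf : constantCoeff f = 0) : Function.Surjective (evalOrigin hf) :=
  fun c => ⟨Ideal.Quotient.mk _ (C c), by rw [evalOrigin_mk, constantCoeff_C]⟩

lemma sub_C_constantCoeff_mem_span (g : MvPolynomial σ A₀) :
    g - C (constantCoeff g) ∈ Ideal.span (X '' (Set.univ : Set σ)) := by
  classical
  rw [mem_ideal_span_X_image]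
  intro m hm
  by_contra! h
  obtain rfl : m = 0 := by
    ext i
    exact h i (Set.mem_univ i)
  rw [mem_support_iff, coeff_sub, coeff_C, if_pos rfl, constantCoeff_eq, sub_self] at hm
  exact hm rfl

/-- Since `evalOrigin` is surjective, this presentation of m + (variables) as a preimage makes it
maximal when m is. -/
lemma comap_evalOrigin (hf : constantCoeff f = 0) (m : Ideal A₀) :
    m.comap (evalOrigin hf) = m.map (algebraMap A₀ (MvPolynomial σ A₀ ⧸ Ideal.span {f})) ⊔
      Ideal.span (Set.range fun i => Ideal.Quotient.mk (Ideal.span {f}) (X i)) := by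
  apply le_antisymm
  · intro q hq
    obtain ⟨g, rfl⟩ := Ideal.Quotient.mk_surjective q
    rw [Ideal.mem_comap, evalOrigin_mk] at hq
    rw [← add_sub_cancel (C (constantCoeff g)) g, map_add]
    refine Submodule.add_mem_sup (Ideal.mem_map_of_mem _ hq) ?_
    have h := Ideal.mem_map_of_mem (Ideal.Quotient.mk (Ideal.span {f}))
      (sub_C_constantCoeff_mem_span g)
    rwa [Ideal.map_span, ← Set.image_comp, Set.image_univ] at h
  · refine sup_le (Ideal.map_le_iff_le_comap.2 fun c hc => ?_) (Ideal.span_le.2 ?_)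
    · change evalOrigin hf (Ideal.Quotient.mk _ (C c)) ∈ m
      rwa [evalOrigin_mk, constantCoeff_C]
    · rintro _ ⟨i, rfl⟩
      change evalOrigin hf (Ideal.Quotient.mk _ (X i)) ∈ m
      rw [evalOrigin_mk, constantCoeff_X]
      exact m.zero_mem

/-- Clearing denominators turns membership in the localized quotient into a membership in the
polynomial ring. -/
lemma mem_span_localization_iff {B : Type*} [CommRing B]
    [Algebra (MvPolynomial σ A₀ ⧸ Ideal.span {f}) B]
    (U : Submonoid (MvPolynomial σ A₀ ⧸ Ideal.span {f})) [IsLocalization U B]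
    (z s t : MvPolynomial σ A₀) :
    algebraMap _ B (Ideal.Quotient.mk (Ideal.span {f}) z) ∈
        Ideal.span {algebraMap _ B (Ideal.Quotient.mk (Ideal.span {f}) s),
          algebraMap _ B (Ideal.Quotient.mk (Ideal.span {f}) t)} ↔
      ∃ g, Ideal.Quotient.mk (Ideal.span {f}) g ∈ U ∧
        g * z ∈ Ideal.span {s, t} ⊔ Ideal.span {f} := by
  have h : (Ideal.span {algebraMap _ B (Ideal.Quotient.mk (Ideal.span {f}) s),
      algebraMap _ B (Ideal.Quotient.mk (Ideal.span {f}) t)} : Ideal B) =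
      ((Ideal.span {s, t}).map (Ideal.Quotient.mk (Ideal.span {f}))).map (algebraMap _ B) := by
    rw [Ideal.map_span, Ideal.map_span, Set.image_pair, Set.image_pair]
  rw [h, IsLocalization.algebraMap_mem_map_algebraMap_iff U]
  constructor
  · rintro ⟨m, hm, hmz⟩
    obtain ⟨g, rfl⟩ := Ideal.Quotient.mk_surjective m
    exact ⟨g, hm, by rwa [← map_mul, Ideal.mem_quotient_iff_mem_sup] at hmz⟩
  · rintro ⟨g, hg, hgz⟩
    exact ⟨_, hg, by rwa [← map_mul, Ideal.mem_quotient_iff_mem_sup]⟩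

lemma constantCoeff_binaryForm {d : ℕ} (hd : 0 < d) (r : Fin (d + 1) → A₀)
    {s t : MvPolynomial σ A₀} (hs : constantCoeff s = 0) (ht : constantCoeff t = 0) :
    constantCoeff (binaryForm r s t) = 0 := by
  rw [binaryForm, map_sum]
  refine Finset.sum_eq_zero fun i _ => ?_
  rw [map_mul, map_mul, map_pow, map_pow, hs, ht, mul_assoc, ← pow_add,
    zero_pow (by have := i.2; omega), mul_zero]

end Hypersurface

section Forms

variable {A₀ : Type u} [CommRing A₀] {d : ℕ}

open BinaryPolynomial

lemma constantCoeff_form (hd : 0 < d) (r : Fin (d + 1) → A₀) (a : ℕ) :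
    constantCoeff (form r a) = 0 := by
  rw [form, map_mul, constantCoeff_binaryForm hd r (constantCoeff_X A₀ 0) (constantCoeff_X A₀ 1),
    mul_zero]

lemma constantCoeff_formR (hd : 0 < d) (r : Fin (d + 1) → A₀) :
    constantCoeff (binaryForm r (X 0 * X 2) (X 1 * X 3) : MvPolynomial (Fin 4) A₀) = 0 :=
  constantCoeff_binaryForm hd r (by simp) (by simp)

lemma HypersurfaceA.maxIdeal_eq (hd : 0 < d) (r : Fin (d + 1) → A₀) (a : ℕ) (m : Ideal A₀) :
    HypersurfaceA.maxIdeal r a m = m.comap (evalOrigin (constantCoeff_form hd r a)) := by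
  rw [comap_evalOrigin, HypersurfaceA.maxIdeal]
  congr 2
  ext q
  simp only [Set.mem_range, Fin.exists_fin_two, Set.mem_insert_iff, Set.mem_singleton_iff,
    eq_comm (a := q)]
  rfl

lemma HypersurfaceR.maxIdeal_eq (hd : 0 < d) (r : Fin (d + 1) → A₀) (m : Ideal A₀) :
    HypersurfaceR.maxIdeal r m = m.comap (evalOrigin (constantCoeff_formR hd r)) := by
  rw [comap_evalOrigin, HypersurfaceR.maxIdeal]
  congr 2
  ext q
  simp only [Set.mem_range, Fin.exists_fin_succ, Set.mem_insert_iff, Set.mem_singleton_iff,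
    eq_comm (a := q)]
  simp only [IsEmpty.exists_iff, or_false]
  rfl

/-- A minimal prime of the determinant of a multidiagonal matrix is the contraction of an associated
prime of `B/(xⁿ, yⁿ)`, for suitable localizations `B` of the hypersurface `A`. -/
theorem exists_mem_associatedPrimes_hypersurfaceA [IsNoetherianRing A₀] (hd : 0 < d)
    (hd_even : Even d) (r : Fin (d + 1) → A₀) (a : ℕ) {B : Type*} [CommRing B]
    [Algebra (HypersurfaceA r a) B] (U : Submonoid (HypersurfaceA r a)) [IsLocalization U B]
    {N : ℕ} {P : Ideal A₀} (hP : P ∈ (Ideal.span {(multidiagonal r N).det}).minimalPrimes)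
    (hU : ∀ w ∈ U, evalOrigin (constantCoeff_form hd r a) w ∉ P) :
    ∃ Q ∈ associatedPrimes B (B ⧸ Ideal.span
        {algebraMap (HypersurfaceA r a) B (HypersurfaceA.var r a 0) ^ (N + a + d / 2),
          algebraMap (HypersurfaceA r a) B (HypersurfaceA.var r a 1) ^ (N + a + d / 2)}),
      Q.comap ((algebraMap (HypersurfaceA r a) B).comp (algebraMap A₀ (HypersurfaceA r a))) =
        P := by
  obtain ⟨w, hw⟩ := exists_annihilator_eq r a hd_even hP
  have hPp : P.IsPrime := hP.isPrime
  let : Algebra A₀ B :=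
    ((algebraMap (HypersurfaceA r a) B).comp (algebraMap A₀ (HypersurfaceA r a))).toAlgebra
  have hB : IsNoetherianRing B := IsLocalization.isNoetherianRing U B inferInstance
  refine exists_mem_associatedPrimes_comap_eq hPp
    (Ideal.Quotient.mk _ (algebraMap (HypersurfaceA r a) B (Ideal.Quotient.mk _ w))) fun c => ?_
  have h1 : algebraMap A₀ B c = algebraMap (HypersurfaceA r a) B (Ideal.Quotient.mk _ (C c)) := rfl
  rw [← Ideal.Quotient.mk_eq_mk, ← Submodule.Quotient.mk_smul, Submodule.Quotient.mk_eq_zero,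
    smul_eq_mul, h1, ← map_mul, ← map_mul, HypersurfaceA.var, HypersurfaceA.var, ← map_pow,
    ← map_pow, ← map_pow, ← map_pow, mem_span_localization_iff U]
  constructor
  · rintro ⟨g, hg, hgz⟩
    rw [← mul_assoc, hw, map_mul, constantCoeff_C] at hgz
    exact (hPp.mem_or_mem hgz).resolve_left (hU _ hg)
  · intro hc
    refine ⟨1, by rw [map_one]; exact U.one_mem, ?_⟩
    rw [one_mul, hw, constantCoeff_C]
    exact hc

end Forms

end

section

open MvPolynomial

/-! ### Descent from A₀[u, v, x, y] to A₀[x, y]. -/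

section Extraction

open BinaryPolynomial

variable {A₀ : Type u} [CommRing A₀]

/-- The substitution `x ↦ ux`, `y ↦ vy`, where `u, v, x, y` are numbered `0, 1, 2, 3`. -/
noncomputable def substProducts : MvPolynomial (Fin 2) A₀ →ₐ[A₀] MvPolynomial (Fin 4) A₀ :=
  aeval ![X 0 * X 2, X 1 * X 3]

/-- The linear map that extracts the monomials `u^p v^q x^(p+k) y^(q+k)` of a polynomial. -/
noncomputable def extract (k : ℕ) : MvPolynomial (Fin 4) A₀ →ₗ[A₀] MvPolynomial (Fin 2) A₀ :=
  (basisMonomials (Fin 4) A₀).constr A₀ fun m =>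
    if m 2 = m 0 + k ∧ m 3 = m 1 + k then monomial (expo (m 0) (m 1)) 1 else 0

lemma extract_monomial (k : ℕ) (m : Fin 4 →₀ ℕ) (c : A₀) :
    extract k (monomial m c) =
      if m 2 = m 0 + k ∧ m 3 = m 1 + k then monomial (expo (m 0) (m 1)) c else 0 := by
  have h : monomial m c = c • (basisMonomials (Fin 4) A₀ m) := by
    rw [coe_basisMonomials, smul_monomial, smul_eq_mul, mul_one]
  rw [h, extract, map_smul, Module.Basis.constr_basis, smul_ite, smul_monomial, smul_zero,
    smul_eq_mul, mul_one]

/-- Multiplication by ux or vy preserves the differences of exponents that `extract` tests, so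
`extract k` is linear over A₀[x, y] acting through x ↦ ux, y ↦ vy. -/
lemma extract_substProducts_mul (k : ℕ) (w : MvPolynomial (Fin 2) A₀)
    (g : MvPolynomial (Fin 4) A₀) : extract k (substProducts w * g) = w * extract k g := by
  have hX : ∀ (g : MvPolynomial (Fin 4) A₀), extract k (X 0 * X 2 * g) = X 0 * extract k g ∧
      extract k (X 1 * X 3 * g) = X 1 * extract k g := by
    intro g
    induction g using MvPolynomial.induction_on' with
    | add p q hp hq =>
      simp only [mul_add, map_add, hp, hq, true_and]
    | monomial m c =>
      constructor
      · simp only [X, monomial_mul, one_mul, extract_monomial]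
        rw [mul_ite, mul_zero, monomial_mul, one_mul]
        refine if_congr (by simp; omega) (congr_arg (fun s => monomial s c) ?_) rfl
        exact finsupp_ext (by simp) (by simp)
      · simp only [X, monomial_mul, one_mul, extract_monomial]
        rw [mul_ite, mul_zero, monomial_mul, one_mul]
        refine if_congr (by simp; omega) (congr_arg (fun s => monomial s c) ?_) rfl
        exact finsupp_ext (by simp) (by simp)
  induction w using MvPolynomial.induction_on generalizing g with
  | C c => rw [← algebraMap_eq, AlgHom.commutes, ← Algebra.smul_def, map_smul, Algebra.smul_def]
  | add p q hp hq => rw [map_add, add_mul, map_add, hp, hq, add_mul]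
  | mul_X p i hp =>
    rw [map_mul substProducts, mul_assoc, hp, mul_assoc]
    congr 1
    fin_cases i
    · simpa [substProducts] using (hX g).1
    · simpa [substProducts] using (hX g).2

lemma extract_mul_pow (k : ℕ) (g : MvPolynomial (Fin 4) A₀) :
    extract k ((X 2 * X 3) ^ k * g) = extract 0 g := by
  induction g using MvPolynomial.induction_on' with
  | add p q hp hq => rw [mul_add, map_add, map_add, hp, hq]
  | monomial m c =>
    simp only [mul_pow, X_pow_eq_monomial, monomial_mul, one_mul, extract_monomial]
    refine if_congr (by simp; omega) (congr_arg (fun s => monomial s c) ?_) rfl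
    exact finsupp_ext (by simp) (by simp)

/-- A surviving monomial has x-exponent p + k ≥ n + k, hence p ≥ n. -/
lemma extract_X_two_pow_mul_mem (k n : ℕ) (g : MvPolynomial (Fin 4) A₀) :
    extract k (X 2 ^ (n + k) * g) ∈ Ideal.span {X 0 ^ n, X 1 ^ n} := by
  induction g using MvPolynomial.induction_on' with
  | add p q hp hq => rw [mul_add, map_add]; exact Ideal.add_mem _ hp hq
  | monomial m c =>
    have h : X 2 ^ (n + k) * monomial m c = monomial (Finsupp.single 2 (n + k) + m) c := by
      rw [X_pow_eq_monomial, monomial_mul, one_mul]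
    rw [h, extract_monomial]
    split_ifs with h
    · rw [mem_span_X_pow_iff]
      intro p q hp hq
      rw [coeff_monomial, if_neg]
      rw [expo_eq_iff]
      simp at h ⊢
      omega
    · exact Ideal.zero_mem _

lemma extract_X_three_pow_mul_mem (k n : ℕ) (g : MvPolynomial (Fin 4) A₀) :
    extract k (X 3 ^ (n + k) * g) ∈ Ideal.span {X 0 ^ n, X 1 ^ n} := by
  induction g using MvPolynomial.induction_on' with
  | add p q hp hq => rw [mul_add, map_add]; exact Ideal.add_mem _ hp hq
  | monomial m c =>
    have h : X 3 ^ (n + k) * monomial m c = monomial (Finsupp.single 3 (n + k) + m) c := by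
      rw [X_pow_eq_monomial, monomial_mul, one_mul]
    rw [h, extract_monomial]
    split_ifs with h
    · rw [mem_span_X_pow_iff]
      intro p q hp hq
      rw [coeff_monomial, if_neg]
      rw [expo_eq_iff]
      simp at h ⊢
      omega
    · exact Ideal.zero_mem _

lemma constantCoeff_extract_zero (g : MvPolynomial (Fin 4) A₀) :
    constantCoeff (extract 0 g) = constantCoeff g := by
  induction g using MvPolynomial.induction_on' with
  | add p q hp hq => rw [map_add, map_add, map_add, hp, hq]
  | monomial m c =>
    classical
    rw [extract_monomial, constantCoeff_monomial]
    have hm : m = 0 ↔ m 0 = 0 ∧ m 1 = 0 ∧ m 2 = 0 ∧ m 3 = 0 := by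
      refine ⟨fun h => by simp [h], fun h => ?_⟩
      ext i
      fin_cases i <;> simp [h]
    split_ifs with h1 h2
    · rw [constantCoeff_monomial, if_pos]
      rw [hm] at h2
      exact finsupp_ext (by simp [h2]) (by simp [h2])
    · rw [constantCoeff_monomial, if_neg]
      intro h3
      have h4 := DFunLike.congr_fun h3 0
      have h5 := DFunLike.congr_fun h3 1
      simp only [expo_zero, expo_one, Finsupp.coe_zero, Pi.zero_apply] at h4 h5
      exact h2 (hm.2 ⟨h4, h5, by omega, by omega⟩)
    · exact absurd (by simp [hm.1 (by assumption)]) h1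
    · exact map_zero _

variable {d : ℕ} (r : Fin (d + 1) → A₀)

/-- The equation of the hypersurface `R`. -/
noncomputable abbrev formR : MvPolynomial (Fin 4) A₀ := binaryForm r (X 0 * X 2) (X 1 * X 3)

lemma substProducts_form : substProducts (form r 0) = formR r := by
  rw [form, pow_zero, one_mul, formR, binaryForm, binaryForm, map_sum]
  refine Finset.sum_congr rfl fun i _ => ?_
  rw [map_mul, map_mul, map_pow, map_pow, AlgHom.commutes]
  simp [substProducts]

lemma extract_mem_truncIdeal {k n : ℕ} {g : MvPolynomial (Fin 4) A₀}
    (hg : g ∈ Ideal.span {X 2 ^ (n + k), X 3 ^ (n + k)} ⊔ Ideal.span {formR r}) :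
    extract k g ∈ truncIdeal r 0 n := by
  obtain ⟨g₁, hg₁, g₂, hg₂, rfl⟩ := Submodule.mem_sup.1 hg
  obtain ⟨p, q, rfl⟩ := Ideal.mem_span_pair.1 hg₁
  obtain ⟨f, rfl⟩ := Ideal.mem_span_singleton.1 hg₂
  rw [map_add, map_add, mul_comm p, mul_comm q, ← substProducts_form, extract_substProducts_mul]
  exact Submodule.add_mem_sup
    (Ideal.add_mem _ (extract_X_two_pow_mul_mem _ _ _) (extract_X_three_pow_mul_mem _ _ _))
    (Ideal.mul_mem_right _ _ (Ideal.mem_span_singleton_self _))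

lemma substProducts_mem {n : ℕ} {g : MvPolynomial (Fin 2) A₀} (hg : g ∈ truncIdeal r 0 n) :
    substProducts g ∈ Ideal.span {X 2 ^ n, X 3 ^ n} ⊔ Ideal.span {formR r} := by
  suffices h : truncIdeal r 0 n ≤ Ideal.comap substProducts
      (Ideal.span {X 2 ^ n, X 3 ^ n} ⊔ Ideal.span {formR r}) from h hg
  refine sup_le (Ideal.span_le.2 ?_) ((Ideal.span_singleton_le_iff_mem _).2 ?_)
  · rintro _ (rfl | rfl)
    · have h : substProducts (X 0 ^ n : MvPolynomial (Fin 2) A₀) = X 0 ^ n * X 2 ^ n := by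
        simp [substProducts, mul_pow]
      rw [SetLike.mem_coe, Ideal.mem_comap, h]
      exact Ideal.mul_mem_left _ _ (Ideal.mem_sup_left (Ideal.subset_span (by simp)))
    · have h : substProducts (X 1 ^ n : MvPolynomial (Fin 2) A₀) = X 1 ^ n * X 3 ^ n := by
        simp [substProducts, mul_pow]
      rw [SetLike.mem_coe, Ideal.mem_comap, h]
      exact Ideal.mul_mem_left _ _ (Ideal.mem_sup_left (Ideal.subset_span (by simp)))
  · rw [Ideal.mem_comap, substProducts_form]
    exact Ideal.mem_sup_right (Ideal.mem_span_singleton_self _)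

end Extraction

/-! ### The variables x, y are nonzerodivisors on R. -/

section NonZeroDivisors

variable {A₀ : Type u} [CommRing A₀] {d : ℕ}

/-- If z p = G k, then p divides k, and cancelling p shows that G divides z. -/
lemma mk_mem_nonZeroDivisors_of_prime {T : Type*} [CommRing T] [IsDomain T] {p G : T} (hp : Prime p)
    (hG : ¬ p ∣ G) :
    Ideal.Quotient.mk (Ideal.span {G}) p ∈ nonZeroDivisors (T ⧸ Ideal.span {G}) := by
  rw [mem_nonZeroDivisors_iff_right]
  intro z hz
  obtain ⟨z, rfl⟩ := Ideal.Quotient.mk_surjective z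
  rw [← map_mul, Ideal.Quotient.eq_zero_iff_mem, Ideal.mem_span_singleton] at hz
  obtain ⟨k, hk⟩ := hz
  obtain ⟨l, rfl⟩ := (hp.dvd_or_dvd (Dvd.intro_left z hk)).resolve_left hG
  rw [Ideal.Quotient.eq_zero_iff_mem, Ideal.mem_span_singleton]
  exact ⟨l, mul_right_cancel₀ hp.ne_zero (by linear_combination hk)⟩

/-- At x = 0 and u = v = y = 1 the form takes the value r_d. -/
lemma not_X_two_dvd_formR {r : Fin (d + 1) → A₀} (hr : r (Fin.last d) ≠ 0) :
    ¬ (X 2 : MvPolynomial (Fin 4) A₀) ∣ formR r := by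
  intro h
  have h1 := map_dvd (aeval (R := A₀) ![(1 : A₀), 1, 0, 1]) h
  apply hr
  rw [formR, binaryForm, map_sum, Fin.sum_univ_castSucc, Finset.sum_eq_zero] at h1
  · simpa using h1
  · intro i _
    have : d - (i : ℕ) ≠ 0 := by have := i.2; omega
    simp [this]

lemma not_X_three_dvd_formR {r : Fin (d + 1) → A₀} (hr : r 0 ≠ 0) :
    ¬ (X 3 : MvPolynomial (Fin 4) A₀) ∣ formR r := by
  intro h
  have h1 := map_dvd (aeval (R := A₀) ![(1 : A₀), 1, 1, 0]) h
  apply hr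
  rw [formR, binaryForm, map_sum, Fin.sum_univ_succ, Finset.sum_eq_zero] at h1
  · simpa using h1
  · intro i _
    simp

end NonZeroDivisors

/-! ### Associated primes of H² over localizations of R. -/

section HypersurfaceR

open BinaryPolynomial

variable {A₀ : Type u} [CommRing A₀] [IsDomain A₀] {d : ℕ}

/-- A minimal prime of the determinant of a multidiagonal matrix is the contraction of an associated
prime of `H²_{(x, y)}(B)`, for suitable localizations `B` of the hypersurface `R`. -/
theorem exists_mem_assLocalCohomologyTwo [IsNoetherianRing A₀] (hd : 0 < d)
    (hd_even : Even d) {r : Fin (d + 1) → A₀} (h0 : r 0 ≠ 0) (hlast : r (Fin.last d) ≠ 0)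
    {B : Type u} [CommRing B]
    [Algebra (HypersurfaceR r) B] (U : Submonoid (HypersurfaceR r)) [IsLocalization U B]
    {N : ℕ} {P : Ideal A₀} (hP : P ∈ (Ideal.span {(multidiagonal r N).det}).minimalPrimes)
    (hU : ∀ w ∈ U, evalOrigin (constantCoeff_formR hd r) w ∉ P) :
    ∃ Q ∈ assLocalCohomologyTwo (algebraMap (HypersurfaceR r) B (HypersurfaceR.var r 2))
        (algebraMap (HypersurfaceR r) B (HypersurfaceR.var r 3)),
      Q.comap ((algebraMap (HypersurfaceR r) B).comp (algebraMap A₀ (HypersurfaceR r))) = P := by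
  obtain ⟨w, hw⟩ := exists_annihilator_eq r 0 hd_even hP
  have hPp : P.IsPrime := hP.isPrime
  let : Algebra A₀ B :=
    ((algebraMap (HypersurfaceR r) B).comp (algebraMap A₀ (HypersurfaceR r))).toAlgebra
  have hB : IsNoetherianRing B := IsLocalization.isNoetherianRing U B inferInstance
  have hx : algebraMap (HypersurfaceR r) B (HypersurfaceR.var r 2) ∈ nonZeroDivisors B :=
    IsLocalization.map_nonZeroDivisors_le U B
      ⟨_, mk_mem_nonZeroDivisors_of_prime X_prime (not_X_two_dvd_formR hlast), rfl⟩
  have hy : algebraMap (HypersurfaceR r) B (HypersurfaceR.var r 3) ∈ nonZeroDivisors B :=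
    IsLocalization.map_nonZeroDivisors_le U B
      ⟨_, mk_mem_nonZeroDivisors_of_prime X_prime (not_X_three_dvd_formR h0), rfl⟩
  obtain ⟨η, hη⟩ := exists_localCohomology_class hx hy
    (algebraMap (HypersurfaceR r) B (Ideal.Quotient.mk _ (substProducts w))) (N + 0 + d / 2)
  refine exists_mem_associatedPrimes_comap_eq hPp η fun c => ?_
  have h1 : algebraMap A₀ B c = algebraMap (HypersurfaceR r) B (Ideal.Quotient.mk _ (C c)) := rfl
  constructor
  · intro hc
    obtain ⟨k, hk⟩ := (hη _).2 hc
    rw [h1, HypersurfaceR.var, HypersurfaceR.var, ← map_pow, ← map_pow, ← map_pow, ← map_pow,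
      ← map_mul, ← map_mul, ← map_mul, ← map_mul, ← map_pow, ← map_pow, ← map_mul, ← map_mul,
      mem_span_localization_iff U] at hk
    obtain ⟨g, hg, hgz⟩ := hk
    have h2 := extract_mem_truncIdeal r hgz
    -- Extraction strips (xy)^k and w(ux, vy), leaving w times `extract 0` of c g, whose constant
    -- term is that of c g.
    have h3 : g * (C c * substProducts w * (X 2 * X 3) ^ k) =
        (X 2 * X 3) ^ k * (substProducts w * (C c * g)) := by ring
    rw [h3, extract_mul_pow, extract_substProducts_mul, mul_comm, hw,
      constantCoeff_extract_zero, map_mul, constantCoeff_C] at h2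
    exact (hPp.mem_or_mem h2).resolve_right (hU _ hg)
  · intro hc
    refine (hη _).1 ?_
    rw [h1, HypersurfaceR.var, HypersurfaceR.var, ← map_pow, ← map_pow, ← map_pow, ← map_pow,
      ← map_mul, ← map_mul, mem_span_localization_iff U]
    refine ⟨1, by rw [map_one]; exact U.one_mem, ?_⟩
    have h2 := (hw (C c)).2 (by rwa [constantCoeff_C])
    have h3 := substProducts_mem r h2
    rw [map_mul, ← algebraMap_eq, AlgHom.commutes, algebraMap_eq] at h3
    rwa [one_mul]

end HypersurfaceR

end

section

open MvPolynomial

/-! ### From infinitely many minimal primes to infinitely many associated primes. -/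

section Final

open BinaryPolynomial

variable {A₀ : Type u} [CommRing A₀] {d : ℕ}

/-- The homogeneous core of P is a prime that still contains I, so minimality makes it equal to P.
-/
lemma Ideal.IsHomogeneous.of_mem_minimalPrimes {𝒜 : ℕ → AddSubgroup A₀} [GradedRing 𝒜]
    {I P : Ideal A₀} (hI : I.IsHomogeneous 𝒜) (hP : P ∈ I.minimalPrimes) :
    P.IsHomogeneous 𝒜 := by
  rw [Ideal.IsHomogeneous.iff_eq]
  refine le_antisymm (Ideal.toIdeal_homogeneousCore_le 𝒜 P) (hP.2 ⟨hP.isPrime.homogeneousCore, ?_⟩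
    (Ideal.toIdeal_homogeneousCore_le 𝒜 P))
  rw [← hI.toIdeal_homogeneousCore_eq_self]
  exact Ideal.homogeneousCore_mono 𝒜 hP.1.2

lemma infinite_of_forall_exists_comap_eq {B : Type*} [CommRing B] (φ : A₀ →+* B)
    {s : Set (Ideal A₀)} {t : Set (Ideal B)} (hs : s.Infinite)
    (h : ∀ P ∈ s, ∃ Q ∈ t, Q.comap φ = P) : t.Infinite :=
  Set.Infinite.of_image (Ideal.comap φ) (hs.mono h)

variable [IsNoetherianRing A₀]

theorem infinite_assPowers_hypersurfaceA (hd : 0 < d) (hd_even : Even d) (r : Fin (d + 1) → A₀)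
    (a : ℕ) {B : Type*} [CommRing B] [Algebra (HypersurfaceA r a) B]
    (U : Submonoid (HypersurfaceA r a)) [IsLocalization U B] (S : Set ℕ)
    (hS : (⋃ n ∈ {n ∈ S | a + d / 2 ≤ n},
      (Ideal.span {(multidiagonal r (n - a - d / 2)).det}).minimalPrimes).Infinite)
    (hU : ∀ P ∈ ⋃ n ∈ {n ∈ S | a + d / 2 ≤ n},
      (Ideal.span {(multidiagonal r (n - a - d / 2)).det}).minimalPrimes,
      ∀ w ∈ U, evalOrigin (constantCoeff_form hd r a) w ∉ P) :
    (assPowers S (algebraMap (HypersurfaceA r a) B (HypersurfaceA.var r a 0))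
      (algebraMap (HypersurfaceA r a) B (HypersurfaceA.var r a 1))).Infinite := by
  refine infinite_of_forall_exists_comap_eq
    ((algebraMap (HypersurfaceA r a) B).comp (algebraMap A₀ (HypersurfaceA r a))) hS
    fun P hP => ?_
  have hUP := hU P hP
  simp only [Set.mem_iUnion] at hP
  obtain ⟨n, ⟨hnS, hn⟩, hP⟩ := hP
  obtain ⟨Q, hQ, hQP⟩ := exists_mem_associatedPrimes_hypersurfaceA hd hd_even r a (B := B) U hP hUP
  -- The truncated subtraction is exact only because n ≥ a + d/2.
  have h : n - a - d / 2 + a + d / 2 = n := by omega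
  rw [h] at hQ
  exact ⟨Q, Set.mem_biUnion hnS hQ, hQP⟩

theorem infinite_assLocalCohomologyTwo_hypersurfaceR [IsDomain A₀] (hd : 0 < d)
    (hd_even : Even d) {r : Fin (d + 1) → A₀} (h0 : r 0 ≠ 0) (hlast : r (Fin.last d) ≠ 0)
    {B : Type u} [CommRing B] [Algebra (HypersurfaceR r) B]
    (U : Submonoid (HypersurfaceR r)) [IsLocalization U B] (a : ℕ) (S : Set ℕ)
    (hS : (⋃ n ∈ {n ∈ S | a + d / 2 ≤ n},
      (Ideal.span {(multidiagonal r (n - a - d / 2)).det}).minimalPrimes).Infinite)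
    (hU : ∀ P ∈ ⋃ n ∈ {n ∈ S | a + d / 2 ≤ n},
      (Ideal.span {(multidiagonal r (n - a - d / 2)).det}).minimalPrimes,
      ∀ w ∈ U, evalOrigin (constantCoeff_formR hd r) w ∉ P) :
    (assLocalCohomologyTwo (algebraMap (HypersurfaceR r) B (HypersurfaceR.var r 2))
      (algebraMap (HypersurfaceR r) B (HypersurfaceR.var r 3))).Infinite := by
  refine infinite_of_forall_exists_comap_eq
    ((algebraMap (HypersurfaceR r) B).comp (algebraMap A₀ (HypersurfaceR r))) hS fun P hP => ?_
  have hUP := hU P hP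
  simp only [Set.mem_iUnion] at hP
  obtain ⟨n, -, hP⟩ := hP
  exact exists_mem_assLocalCohomologyTwo hd hd_even h0 hlast U hP hUP

end Final

end

theorem mainTheorem4 {A₀ : Type u} [CommRing A₀] [IsDomain A₀] [IsNoetherianRing A₀]
    (d : ℕ) (hd : 0 < d) (hd_even : Even d) (r : Fin (d + 1) → A₀) (a : ℕ) (S : Set ℕ)
    (hS : (⋃ n ∈ {n ∈ S | a + d / 2 ≤ n},
      (Ideal.span {(multidiagonal r (n - a - d / 2)).det}).minimalPrimes).Infinite) :
    (assPowers S (HypersurfaceA.var r a 0) (HypersurfaceA.var r a 1)).Infinite ∧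
    (r 0 ≠ 0 → r (Fin.last d) ≠ 0 →
      (assLocalCohomologyTwo (HypersurfaceR.var r 2) (HypersurfaceR.var r 3)).Infinite) ∧
    ∀ m : Ideal A₀,
      ((∃ _ : IsLocalRing A₀, m = IsLocalRing.maximalIdeal A₀) ∨
        (∃ (𝒜 : ℕ → AddSubgroup A₀) (_ : GradedRing 𝒜), IsHomogeneousMaximalIdeal 𝒜 m ∧
          ∀ n : ℕ, SetLike.IsHomogeneousElem 𝒜 (multidiagonal r n).det)) →
      (∃ _ : (HypersurfaceA.maxIdeal r a m).IsMaximal,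
        (assPowers S
          (algebraMap (HypersurfaceA r a) (Localization.AtPrime (HypersurfaceA.maxIdeal r a m))
            (HypersurfaceA.var r a 0))
          (algebraMap (HypersurfaceA r a) (Localization.AtPrime (HypersurfaceA.maxIdeal r a m))
            (HypersurfaceA.var r a 1))).Infinite) ∧
      (r 0 ≠ 0 → r (Fin.last d) ≠ 0 →
        ∃ _ : (HypersurfaceR.maxIdeal r m).IsMaximal,
          (assLocalCohomologyTwo
            (algebraMap (HypersurfaceR r) (Localization.AtPrime (HypersurfaceR.maxIdeal r m))
              (HypersurfaceR.var r 2))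
            (algebraMap (HypersurfaceR r) (Localization.AtPrime (HypersurfaceR.maxIdeal r m))
              (HypersurfaceR.var r 3))).Infinite) := by
  have hprime : ∀ P ∈ ⋃ n ∈ {n ∈ S | a + d / 2 ≤ n},
      (Ideal.span {(multidiagonal r (n - a - d / 2)).det}).minimalPrimes, P.IsPrime := by
    intro P hP
    simp only [Set.mem_iUnion] at hP
    obtain ⟨n, -, hP⟩ := hP
    exact hP.isPrime
  refine ⟨?_, fun h0 hlast => ?_, fun m hm => ?_⟩
  -- The ring itself is treated as its localization at the trivial submonoid, whose only element 1
  -- evaluates to 1 ∉ P.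
  · have : IsLocalization (⊥ : Submonoid (HypersurfaceA r a)) (HypersurfaceA r a) :=
      IsLocalization.self bot_le
    refine infinite_assPowers_hypersurfaceA hd hd_even r a
      (B := HypersurfaceA r a) ⊥ S hS fun P hP w hw => ?_
    rw [Submonoid.mem_bot.1 hw, map_one]
    exact P.ne_top_iff_one.1 (hprime P hP).ne_top
  · have : IsLocalization (⊥ : Submonoid (HypersurfaceR r)) (HypersurfaceR r) :=
      IsLocalization.self bot_le
    refine infinite_assLocalCohomologyTwo_hypersurfaceR hd hd_even h0 hlast
      (B := HypersurfaceR r) ⊥ a S hS fun P hP w hw => ?_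
    rw [Submonoid.mem_bot.1 hw, map_one]
    exact P.ne_top_iff_one.1 (hprime P hP).ne_top
  · have hmax : m.IsMaximal := by
      rcases hm with ⟨_, rfl⟩ | ⟨𝒜, _, hm, -⟩
      · infer_instance
      · exact hm.isMaximal
    have hle : ∀ P ∈ ⋃ n ∈ {n ∈ S | a + d / 2 ≤ n},
        (Ideal.span {(multidiagonal r (n - a - d / 2)).det}).minimalPrimes, P ≤ m := by
      intro P hP
      have hPp := hprime P hP
      rcases hm with ⟨_, rfl⟩ | ⟨𝒜, _, hm, hdet⟩
      · exact IsLocalRing.le_maximalIdeal hPp.ne_top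
      · simp only [Set.mem_iUnion] at hP
        obtain ⟨n, -, hP⟩ := hP
        refine hm.le_of_isHomogeneous P (Ideal.IsHomogeneous.of_mem_minimalPrimes ?_ hP) hPp.ne_top
        refine Ideal.homogeneous_span 𝒜 _ fun z hz => ?_
        rw [Set.mem_singleton_iff.1 hz]
        exact hdet _
    refine ⟨?_, fun h0 hlast => ?_⟩
    · have hM : (HypersurfaceA.maxIdeal r a m).IsMaximal := by
        rw [HypersurfaceA.maxIdeal_eq hd]
        exact Ideal.comap_isMaximal_of_surjective _ (evalOrigin_surjective _)
      refine ⟨hM, infinite_assPowers_hypersurfaceA hd hd_even r a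
        (HypersurfaceA.maxIdeal r a m).primeCompl S hS fun P hP w hw h => hw ?_⟩
      rw [HypersurfaceA.maxIdeal_eq hd]
      exact hle P hP h
    · have hM : (HypersurfaceR.maxIdeal r m).IsMaximal := by
        rw [HypersurfaceR.maxIdeal_eq hd]
        exact Ideal.comap_isMaximal_of_surjective _ (evalOrigin_surjective _)
      refine ⟨hM, infinite_assLocalCohomologyTwo_hypersurfaceR hd hd_even h0 hlast
        (HypersurfaceR.maxIdeal r m).primeCompl a S hS fun P hP w hw h => hw ?_⟩
      rw [HypersurfaceR.maxIdeal_eq hd]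
      exact hle P hP h
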